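/- Let $m,n\ge 0$ be integers. An $(m,n)$-colored-mixed graph is a finite loopless graph having $m$ colors of arcs and $n$ colors of edges, in which any two vertices are joined by at most one arc or edge (counting all colors and both orientations). A homomorphism from an $(m,n)$-colored-mixed graph $G$ to an $(m,n)$-colored-mixed graph $H$ is a mapping $\varphi:V(G)\to V(H)$ such that every edge of $G$ is mapped to an edge of $H$ of the same color and every arc of $G$ is mapped to an arc of $H$ of the same color and orientation. For $g\ge 3$, let $P_g^{(m,n)}$ be the class of all $(m,n)$-colored-mixed graphs whose underlying simple graph is planar and has girth at least $g$ (a forest has infinite girth). An $(m,n)$-colored-mixed graph $T$ is $P_g^{(m,n)}$-universal if every graph in $P_g^{(m,n)}$ admits a homomorphism to $T$. Theorem. For every integer $g\ge 3$ and all integers $m,n\ge 0$ with $2m+n\ge 3$, there exists no planar $P_g^{(m,n)}$-universal $(m,n)$-colored-mixed graph. -/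

import Mathlib

/-- The Euclidean plane. -/
abbrev Plane : Type := EuclideanSpace ℝ (Fin 2)

/-- `IsPolygonalArc x y A`: the set `A` is a simple polygonal arc with endpoints `x` and `y`, i.e. a
concatenation of finitely many nondegenerate straight line segments leading from `x` to `y` that does
not meet itself. (As is usual in graph theory, e.g. in the textbooks of Diestel and West, the edges of
a plane graph are polygonal arcs.) -/
inductive IsPolygonalArc : Plane → Plane → Set Plane → Prop
  /-- A nondegenerate segment is a polygonal arc. -/
  | single {x y : Plane} (hxy : x ≠ y) : IsPolygonalArc x y (segment ℝ x y)
  /-- A segment followed by a polygonal arc that it meets only in its final point. -/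
  | cons {x y z : Plane} {A : Set Plane} (hxy : x ≠ y) (hA : IsPolygonalArc y z A)
      (hmeet : segment ℝ x y ∩ A = {y}) : IsPolygonalArc x z (segment ℝ x y ∪ A)

/-- A drawing of a simple graph in the plane without crossings: vertices are distinct points, every
edge is an arc joining its two ends, an edge passes through no vertex other than its ends, and two
distinct edges meet only in common ends. -/
structure PlaneDrawing {V : Type*} (G : SimpleGraph V) where
  /-- The point that represents a vertex. -/
  point : V → Plane
  /-- The arc that represents an edge (only its values on edges matter). -/
  curve : Sym2 V → Set Plane
  point_injective : Function.Injective point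
  isPolygonalArc : ∀ u v : V, G.Adj u v → IsPolygonalArc (point u) (point v) (curve s(u, v))
  mem_of_point_mem : ∀ e ∈ G.edgeSet, ∀ w : V, point w ∈ curve e → w ∈ e
  eq_point_of_mem : ∀ e ∈ G.edgeSet, ∀ f ∈ G.edgeSet, e ≠ f → ∀ p : Plane,
    p ∈ curve e → p ∈ curve f → ∃ w : V, w ∈ e ∧ w ∈ f ∧ p = point w

/-- An `(m, n)`-colored-mixed graph on the vertex set `V`: it has `m` colors of arcs and `n` colors of
edges, no loops, and at most one arc or edge (of whatever color and orientation) between any two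
vertices. -/
structure ColoredMixedGraph (m n : ℕ) (V : Type*) where
  /-- `Arc i u v`: there is an arc of color `i` from `u` to `v`. -/
  Arc : Fin m → V → V → Prop
  /-- `Edge j u v`: there is an edge of color `j` between `u` and `v`. -/
  Edge : Fin n → V → V → Prop
  edge_symm : ∀ (j : Fin n) (u v : V), Edge j u v → Edge j v u
  arc_loopless : ∀ (i : Fin m) (u : V), ¬ Arc i u u
  edge_loopless : ∀ (j : Fin n) (u : V), ¬ Edge j u u
  arc_unique : ∀ (i i' : Fin m) (u v : V), Arc i u v → Arc i' u v → i = i'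
  arc_asymm : ∀ (i i' : Fin m) (u v : V), Arc i u v → ¬ Arc i' v u
  edge_unique : ∀ (j j' : Fin n) (u v : V), Edge j u v → Edge j' u v → j = j'
  arc_not_edge : ∀ (i : Fin m) (j : Fin n) (u v : V), Arc i u v → ¬ Edge j u v

namespace ColoredMixedGraph

variable {m n : ℕ} {V W : Type*}

/-- The underlying simple graph, obtained by forgetting colors and orientations. -/
def underlying (G : ColoredMixedGraph m n V) : SimpleGraph V where
  Adj u v := (∃ i, G.Arc i u v) ∨ (∃ i, G.Arc i v u) ∨ ∃ j, G.Edge j u v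
  symm := by
    constructor
    rintro u v (h | h | ⟨j, h⟩)
    · exact Or.inr (Or.inl h)
    · exact Or.inl h
    · exact Or.inr (Or.inr ⟨j, G.edge_symm j u v h⟩)
  loopless := by
    constructor
    rintro u (⟨i, h⟩ | ⟨i, h⟩ | ⟨j, h⟩)
    · exact G.arc_loopless i u h
    · exact G.arc_loopless i u h
    · exact G.edge_loopless j u h

/-- A map of vertices is a homomorphism if it preserves arcs with their color and orientation and
edges with their color. -/
def IsHom (G : ColoredMixedGraph m n V) (H : ColoredMixedGraph m n W) (φ : V → W) : Prop :=
  (∀ i u v, G.Arc i u v → H.Arc i (φ u) (φ v)) ∧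
    ∀ j u v, G.Edge j u v → H.Edge j (φ u) (φ v)

/-- A colored-mixed graph is planar if its underlying graph has a drawing in the plane. -/
def IsPlanar (G : ColoredMixedGraph m n V) : Prop :=
  Nonempty (PlaneDrawing G.underlying)

/-- The condition that a (finite) graph be in the class `P_g^{(m, n)}`: it is planar and its girth,
which is infinite for a forest, is at least `g`. -/
def IsPlanarOfGirthAtLeast (g : ℕ) (G : ColoredMixedGraph m n V) : Prop :=
  G.IsPlanar ∧ (g : ℕ∞) ≤ G.underlying.egirth

/-- `T` is `P_g^{(m, n)}`-universal: every finite planar `(m, n)`-colored-mixed graph of girth at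
least `g` admits a homomorphism to `T`. -/
def IsUniversal (g : ℕ) (T : ColoredMixedGraph m n W) : Prop :=
  ∀ (U : Type) [Finite U] (G : ColoredMixedGraph m n U),
    G.IsPlanarOfGirthAtLeast g → ∃ φ : U → W, G.IsHom T φ

end ColoredMixedGraph

/-!
Suppose that a planar graph `T` receives homomorphisms from all planar graphs of girth at least `g`.
The proof shows that `T` contains a subgraph that is too dense to be planar.

The only sources needed are *sketches*: graphs `G` of girth at least `g` that are subgraphs of a
graph `H` drawn with straight edges. An edge `uv` of a straight-line drawing can be accompanied by a
new path from `u` to `v`: a new vertex joined to both ends of an edge fits in close to the middle of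
this edge, and this can be repeated (`IsStraightDrawing.exists_apexGraph`). If the path is long, the
girth does not drop below `g`, and the colors and orientations along the path, its *word*, are
arbitrary. So every sketch can be enriched such that between any two formerly adjacent vertices
there is a walk spelling a given word of length at least `g` (`IsSketch.exists_enrichment`).

Let `X` be a subgraph of `T` with as few adjacencies as possible that still receives all sketches.
If `u` and `v` are adjacent in `X`, some sketch has no homomorphism to `X` without this adjacency.
Homomorphisms of its enrichments to `X` must use the adjacency, and so every word of length at least
`g` is spelled by a walk of `X` from `u` to `v` (`exists_isSaturated_target`). In a component of `X`
with `N` vertices, the word with constant letter an edge color shows that the edges of each color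
form a connected spanning graph, with at least `N - 1` edges. The words that follow arcs of one color
alternately forwards and backwards show that the bipartite double of each color of arcs is connected,
so that there are at least `2 * N - 1` arcs of this color. Altogether there are at least
`m * (2 * N - 1) + n * (N - 1) ≥ 3 * N - 3` adjacencies (`three_mul_card_le`), whereas a planar graph
that has an edge and no vertices of degree one has at most `3 * N - 6` edges.

This last bound (`PlaneDrawing.card_edgeSet_add_six_le`) is proved for the polygonal drawings of the
definition without the Jordan curve theorem. An element `C` of the cycle space over `ZMod 2` has a
winding parity, which counts the crossings of `C` with a ray of generic direction. It is locally
constant off the drawing, and on the two sides of an edge `e` it differs by `C e`. Going along the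
right side of an edge to its head and turning there (`exists_sameFace_of_rays`), one reaches the
right side of another edge, in the same face. Hence winding parities, together with the constants,
embed a space of dimension at least `E - V + 2` into the functions on classes of sides, and since
each class has at least three of the `2 * E` sides, `E - V + 2 ≤ 2 * E / 3`.
-/

namespace PlaneGraph

open Filter Topology

/-! ### Sides of segments and faces -/

/-- The cross product of two plane vectors. -/
def cross (a b : Plane) : ℝ := a 0 * b 1 - a 1 * b 0

/-- The point `p` lies in the face of `D` that is to the left of `q` when one looks in the direction
`d`: all points near `q` to the left of the line through `q` with direction `d` can be joined to
`p` off `D`. The face to the right is obtained with `-d` in place of `d`. -/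
def LeftOf (D : Set Plane) (q d p : Plane) : Prop :=
  ∀ᶠ p' in 𝓝 q, 0 < cross d (p' - q) → JoinedIn Dᶜ p p'

/-- The face of `D` to the left of `q` in direction `d` is the face to the left of `q'` in
direction `d'`. -/
def SameFace (D : Set Plane) (q d q' d' : Plane) : Prop :=
  ∃ p, LeftOf D q d p ∧ LeftOf D q' d' p

/-- The quarter turn. -/
def quarterTurn (a : Plane) : Plane := !₂[-a 1, a 0]

@[simp] lemma quarterTurn_zero (a : Plane) : quarterTurn a 0 = -a 1 := rfl
@[simp] lemma quarterTurn_one (a : Plane) : quarterTurn a 1 = a 0 := rfl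

lemma plane_ext {a b : Plane} (h0 : a 0 = b 0) (h1 : a 1 = b 1) : a = b := by
  ext i; fin_cases i <;> assumption

lemma sq_add_sq_pos {d : Plane} (hd : d ≠ 0) : 0 < d 0 ^ 2 + d 1 ^ 2 := by
  by_contra h
  apply hd
  apply plane_ext <;> simp <;> nlinarith [sq_nonneg (d 0), sq_nonneg (d 1)]

@[fun_prop] lemma continuous_cross (d : Plane) : Continuous (cross d) := by
  unfold cross; fun_prop

lemma frequently_left {d : Plane} (hd : d ≠ 0) (q : Plane) :
    ∃ᶠ p in 𝓝 q, 0 < cross d (p - q) := by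
  have ht : Tendsto (fun s : ℝ => q + s • quarterTurn d) (𝓝[>] 0) (𝓝 q) := by
    have : Continuous (fun s : ℝ => q + s • quarterTurn d) := by fun_prop
    simpa using (this.tendsto 0).mono_left nhdsWithin_le_nhds
  refine ht.frequently (Eventually.frequently ?_)
  filter_upwards [self_mem_nhdsWithin] with s hs
  have := sq_add_sq_pos hd
  have hs' : 0 < s := hs
  simp only [cross, PiLp.sub_apply, PiLp.add_apply, PiLp.smul_apply, quarterTurn_zero,
    quarterTurn_one, smul_eq_mul]
  nlinarith [mul_pos hs' this]

lemma LeftOf.joinedIn {D : Set Plane} {q d p p' : Plane} (hd : d ≠ 0) (h : LeftOf D q d p)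
    (h' : LeftOf D q d p') : JoinedIn Dᶜ p p' := by
  obtain ⟨x, hx, h1, h2⟩ := ((frequently_left hd q).and_eventually (h.and h')).exists
  exact (h1 hx).trans (h2 hx).symm

lemma LeftOf.of_joinedIn {D : Set Plane} {q d p p' : Plane} (h : LeftOf D q d p)
    (h' : JoinedIn Dᶜ p p') : LeftOf D q d p' :=
  h.mono fun _ hx hx' => h'.symm.trans (hx hx')

lemma cross_smul_left (c : ℝ) (d e : Plane) : cross (c • d) e = c * cross d e := by
  simp [cross]; ring

lemma LeftOf.smul {D : Set Plane} {q d p : Plane} (h : LeftOf D q d p) {c : ℝ} (hc : 0 < c) :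
    LeftOf D q (c • d) p :=
  h.mono fun _ hx hx' => hx (by rw [cross_smul_left] at hx'; exact pos_of_mul_pos_right hx' hc.le)

lemma SameFace.symm {D : Set Plane} {q d q' d' : Plane} (h : SameFace D q d q' d') :
    SameFace D q' d' q d :=
  let ⟨p, h1, h2⟩ := h
  ⟨p, h2, h1⟩

lemma SameFace.trans {D : Set Plane} {q d q' d' q'' d'' : Plane} (hd : d' ≠ 0)
    (h : SameFace D q d q' d') (h' : SameFace D q' d' q'' d'') : SameFace D q d q'' d'' := by
  obtain ⟨p, h1, h2⟩ := h
  obtain ⟨p', h3, h4⟩ := h'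
  exact ⟨p, h1, h4.of_joinedIn (h3.joinedIn hd h2)⟩

lemma SameFace.smul {D : Set Plane} {q d q' d' : Plane} (h : SameFace D q d q' d') {c c' : ℝ}
    (hc : 0 < c) (hc' : 0 < c') : SameFace D q (c • d) q' (c' • d') :=
  let ⟨p, h1, h2⟩ := h
  ⟨p, h1.smul hc, h2.smul hc'⟩

/-- A convex half disk off `D` lies in one face. -/
lemma exists_leftOf {D : Set Plane} {q d : Plane} (hd : d ≠ 0)
    (h : ∀ᶠ p in 𝓝 q, p ∈ D → cross d (p - q) = 0) : ∃ p, LeftOf D q d p := by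
  obtain ⟨r, hr, hball⟩ := Metric.eventually_nhds_iff_ball.1 h
  obtain ⟨p, hp, hpr⟩ :=
    ((frequently_left hd q).and_eventually (Metric.ball_mem_nhds q hr)).exists
  refine ⟨p, ?_⟩
  filter_upwards [Metric.ball_mem_nhds q hr] with p' hp' hpos
  refine JoinedIn.of_segment_subset fun x hx => ?_
  have hxb : x ∈ Metric.ball q r := (convex_ball q r).segment_subset hpr hp' hx
  intro hxD
  have h0 := hball x hxb hxD
  obtain ⟨a, b, ha, hb, hab, rfl⟩ := hx
  have : cross d (a • p + b • p' - q) = a * cross d (p - q) + b * cross d (p' - q) := by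
    simp only [cross, PiLp.sub_apply, PiLp.add_apply, PiLp.smul_apply, smul_eq_mul]
    linear_combination (d 0 * q 1 - d 1 * q 0) * hab
  rw [this] at h0
  rcases ha.eq_or_lt with rfl | ha
  · have : b = 1 := by linarith
    subst this; simp at h0; linarith
  · nlinarith [mul_pos ha hp, mul_nonneg hb hpos.le]

/-- Along an open segment at which `D` has no further branches, the face on a given side does not
change. -/
lemma sameFace_of_mem_openSegment {D : Set Plane} {a b d q q' : Plane} (hd : d ≠ 0)
    (hab : ∀ x ∈ segment ℝ a b, ∀ y ∈ segment ℝ a b, cross d (x - y) = 0)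
    (h : ∀ q ∈ openSegment ℝ a b, ∀ᶠ p in 𝓝 q, p ∈ D → p ∈ segment ℝ a b)
    (hq : q ∈ openSegment ℝ a b) (hq' : q' ∈ openSegment ℝ a b) : SameFace D q d q' d := by
  have hex : ∀ q ∈ openSegment ℝ a b, ∃ p, LeftOf D q d p := fun q hq =>
    exists_leftOf hd ((h q hq).mono fun p hp hpD =>
      hab p (hp hpD) q (openSegment_subset_segment _ _ _ hq))
  have key : ∀ p, LeftOf D q d p → LeftOf D q' d p := by
    refine IsPreconnected.induction₂' (P := fun q q' => ∀ p, LeftOf D q d p → LeftOf D q' d p)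
      (convex_openSegment a b).isPreconnected ?_ ?_ hq hq'
    · intro x hx
      obtain ⟨p₀, hp₀⟩ := hex x hx
      have hU := eventually_eventually_nhds.2 hp₀
      filter_upwards [nhdsWithin_le_nhds hU, self_mem_nhdsWithin] with y hy hys
      have hyp : LeftOf D y d p₀ := by
        refine hy.mono fun z hz hz' => hz ?_
        have := hab y (openSegment_subset_segment _ _ _ hys) x
          (openSegment_subset_segment _ _ _ hx)
        simp only [cross, PiLp.sub_apply] at this hz' ⊢
        linarith
      exact ⟨fun p hp => hyp.of_joinedIn (hp₀.joinedIn hd hp),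
        fun p hp => hp₀.of_joinedIn (hyp.joinedIn hd hp)⟩
    · intro x y z _ _ _ h1 h2 p hp
      exact h2 p (h1 p hp)
  obtain ⟨p, hp⟩ := hex q hq
  exact ⟨p, hp, key p hp⟩

/-! ### Turning around a point -/

/-- The vector `u` turned counterclockwise by the angle `θ`. -/
noncomputable def rotate (u : Plane) (θ : ℝ) : Plane := Real.cos θ • u + Real.sin θ • quarterTurn u

lemma continuous_rotate (u : Plane) : Continuous (rotate u) := by
  unfold rotate; fun_prop

lemma rotate_zero (u : Plane) : rotate u 0 = u := by simp [rotate]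

lemma cross_rotate {u : Plane} (hu : u 0 ^ 2 + u 1 ^ 2 = 1) (θ θ' : ℝ) :
    cross (rotate u θ) (rotate u θ') = Real.sin (θ' - θ) := by
  simp only [cross, rotate, PiLp.add_apply, PiLp.smul_apply, smul_eq_mul, quarterTurn_zero,
    quarterTurn_one, Real.sin_sub]
  linear_combination (Real.sin θ' * Real.cos θ - Real.cos θ' * Real.sin θ) * hu

lemma rotate_normSq {u : Plane} (hu : u 0 ^ 2 + u 1 ^ 2 = 1) (θ : ℝ) :
    rotate u θ 0 ^ 2 + rotate u θ 1 ^ 2 = 1 := by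
  simp only [rotate, PiLp.add_apply, PiLp.smul_apply, smul_eq_mul, quarterTurn_zero,
    quarterTurn_one]
  linear_combination (Real.cos θ ^ 2 + Real.sin θ ^ 2) * hu + Real.cos_sq_add_sin_sq θ

lemma rotate_injOn {u : Plane} (hu : u 0 ^ 2 + u 1 ^ 2 = 1) {θ θ' : ℝ}
    (h : rotate u θ = rotate u θ') (h1 : -(2 * Real.pi) < θ - θ') (h2 : θ - θ' < 2 * Real.pi) :
    θ = θ' := by
  have e0 := congrArg (fun p : Plane => p 0) h
  have e1 := congrArg (fun p : Plane => p 1) h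
  simp only [rotate, PiLp.add_apply, PiLp.smul_apply, smul_eq_mul, quarterTurn_zero,
    quarterTurn_one] at e0 e1
  have hc : Real.cos θ = Real.cos θ' := by
    linear_combination (u 0) * e0 + (u 1) * e1 + (Real.cos θ' - Real.cos θ) * hu
  have hs : Real.sin θ = Real.sin θ' := by
    linear_combination (u 0) * e1 - (u 1) * e0 + (Real.sin θ' - Real.sin θ) * hu
  have : Real.cos (θ - θ') = 1 := by
    rw [Real.cos_sub, hc, hs]; linear_combination Real.cos_sq_add_sin_sq θ'
  have := (Real.cos_eq_one_iff_of_lt_of_lt h1 h2).1 this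
  linarith

lemma exists_rotate_eq {u w : Plane} (hu : u 0 ^ 2 + u 1 ^ 2 = 1) (hw : w 0 ^ 2 + w 1 ^ 2 = 1)
    (huw : w ≠ u) : ∃ θ, 0 < θ ∧ θ < 2 * Real.pi ∧ w = rotate u θ := by
  set a := u 0 * w 0 + u 1 * w 1 with ha
  set b := u 0 * w 1 - u 1 * w 0 with hb
  have hab : a ^ 2 + b ^ 2 = 1 := by
    rw [ha, hb]; linear_combination (w 0 ^ 2 + w 1 ^ 2) * hu + hw
  have hw' : ∀ θ, Real.cos θ = a → Real.sin θ = b → w = rotate u θ := by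
    intro θ h1 h2
    apply plane_ext <;>
    simp only [rotate, PiLp.add_apply, PiLp.smul_apply, smul_eq_mul, quarterTurn_zero,
      quarterTurn_one, h1, h2, ha, hb]
    · linear_combination (-w 0) * hu
    · linear_combination (-w 1) * hu
  have h1 : -1 ≤ a := by nlinarith
  have h2 : a ≤ 1 := by nlinarith
  have hpi := Real.pi_pos
  have hs : Real.sin (Real.arccos a) = |b| := by
    rw [Real.sin_arccos, ← Real.sqrt_sq_eq_abs]; congr 1; linarith
  have hc := Real.cos_arccos h1 h2
  rcases le_or_gt 0 b with hb0 | hb0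
  · refine ⟨Real.arccos a, ?_, by linarith [Real.arccos_le_pi a], hw' _ hc ?_⟩
    · refine lt_of_le_of_ne (Real.arccos_nonneg a) fun h => huw ?_
      rw [hw' _ hc (by rw [hs, abs_of_nonneg hb0]), ← h, rotate_zero]
    · rw [hs, abs_of_nonneg hb0]
  · refine ⟨2 * Real.pi - Real.arccos a, by linarith [Real.arccos_le_pi a], ?_, hw' _ ?_ ?_⟩
    · have : 0 < Real.arccos a := by
        refine lt_of_le_of_ne (Real.arccos_nonneg a) fun h => ?_
        rw [← h, Real.sin_zero] at hs
        have := abs_pos.2 hb0.ne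
        linarith
      linarith
    · rw [Real.cos_two_pi_sub, hc]
    · rw [Real.sin_two_pi_sub, hs, abs_of_neg hb0, neg_neg]

/-- Several rays leave the point `c` and `D` is contained in their union near `c`. Turning
counterclockwise from the ray with direction `u i`, one reaches another ray, and the face to the
left of the first ray is the face to the right of the other one. -/
lemma exists_sameFace_of_rays {ι : Type*} [Finite ι] {D : Set Plane} {c : Plane} {u : ι → Plane}
    (hu : ∀ i, u i 0 ^ 2 + u i 1 ^ 2 = 1) (hinj : Function.Injective u)
    (hD : ∀ᶠ p in 𝓝 c, p ∈ D → ∃ i, ∃ t : ℝ, 0 ≤ t ∧ p = c + t • u i)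
    (hsep : ∀ i, ∀ᶠ ρ : ℝ in 𝓝[>] 0, ∀ᶠ p in 𝓝 (c + ρ • u i),
      p ∈ D → cross (u i) (p - (c + ρ • u i)) = 0)
    (i : ι) (hi : ∃ j, j ≠ i) :
    ∃ j, j ≠ i ∧ ∀ᶠ ρ : ℝ in 𝓝[>] 0, SameFace D (c + ρ • u i) (u i) (c + ρ • u j) (-u j) := by
  classical
  have := Fintype.ofFinite ι
  have hθ : ∀ j, j ≠ i → ∃ θ, 0 < θ ∧ θ < 2 * Real.pi ∧ u j = rotate (u i) θ := fun j hj =>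
    exists_rotate_eq (hu i) (hu j) fun h => hj (hinj h)
  choose! θ hθ0 hθ1 hθ2 using hθ
  obtain ⟨j, hj, hmin⟩ := Finset.exists_min_image (Finset.univ.filter (· ≠ i)) θ
    (by obtain ⟨j, hj⟩ := hi; exact ⟨j, by simpa using hj⟩)
  have hj : j ≠ i := by simpa using hj
  refine ⟨j, hj, ?_⟩
  obtain ⟨r, hr, hball⟩ := Metric.eventually_nhds_iff_ball.1 hD
  have hlt : ∀ᶠ ρ : ℝ in 𝓝[>] 0, ρ < r := nhdsWithin_le_nhds (Iio_mem_nhds hr)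
  filter_upwards [hsep i, hsep j, hlt, self_mem_nhdsWithin] with ρ hsi hsj hρr hρ
  have hρ0 : 0 < ρ := hρ
  let φ : ℝ → Plane := fun τ => c + ρ • rotate (u i) τ
  have hφc : Continuous φ := by
    have := continuous_rotate (u i)
    fun_prop
  have hφD : ∀ τ ∈ Set.Ioo 0 (θ j), φ τ ∈ Dᶜ := by
    intro τ hτ hmem
    have hrot := rotate_normSq (hu i) τ
    have hb : φ τ ∈ Metric.ball c r := by
      rw [Metric.mem_ball, dist_eq_norm]
      have : φ τ - c = ρ • rotate (u i) τ := by simp [φ]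
      rw [this, norm_smul, EuclideanSpace.norm_eq, Fin.sum_univ_two]
      simp only [Real.norm_eq_abs, sq_abs, hrot, Real.sqrt_one, mul_one, abs_of_pos hρ0, hρr]
    obtain ⟨k, t, ht, hk⟩ := hball _ hb hmem
    have hk : ρ • rotate (u i) τ = t • u k := by simpa [φ] using hk
    have e0 := congrArg (fun p : Plane => p 0) hk
    have e1 := congrArg (fun p : Plane => p 1) hk
    simp only [PiLp.smul_apply, smul_eq_mul] at e0 e1
    have hsq : ρ ^ 2 = t ^ 2 := by
      linear_combination (-ρ ^ 2) * hrot + t ^ 2 * hu k +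
        (ρ * rotate (u i) τ 0 + t * u k 0) * e0 + (ρ * rotate (u i) τ 1 + t * u k 1) * e1
    have hρt : ρ = t := by
      rcases sq_eq_sq_iff_eq_or_eq_neg.1 hsq with h | h <;> linarith
    subst hρt
    have hk : rotate (u i) τ = u k := smul_right_injective _ hρ0.ne' hk
    have hjπ := hθ1 j hj
    by_cases hki : k = i
    · subst hki
      have := rotate_injOn (hu k) (hk.trans (rotate_zero _).symm) (by linarith [hτ.1, Real.pi_pos])
        (by linarith [hτ.2])
      exact hτ.1.ne' this
    · have h0 := hθ0 k hki
      have h1 := hθ1 k hki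
      have := rotate_injOn (hu i) (hk.trans (hθ2 k hki)) (by linarith [hτ.1]) (by linarith [hτ.2])
      have hm := hmin k (by simpa using hki)
      linarith [hτ.2]
  have hconn : ∀ τ ∈ Set.Ioo 0 (θ j), ∀ τ' ∈ Set.Ioo 0 (θ j), JoinedIn Dᶜ (φ τ) (φ τ') := by
    intro τ hτ τ' hτ'
    exact ((JoinedIn.of_segment_subset
      ((convex_Ioo 0 (θ j)).segment_subset hτ hτ')).map hφc).mono (Set.image_subset_iff.2 hφD)
  have hθj := hθ0 j hj
  have hmid : θ j / 2 ∈ Set.Ioo 0 (θ j) := ⟨by linarith, by linarith⟩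
  have hne : ∀ k, u k ≠ 0 := fun k h => by simpa [h] using hu k
  have hφ0 : φ 0 = c + ρ • u i := by simp [φ, rotate_zero]
  have hφj : φ (θ j) = c + ρ • u j := by simp [φ, hθ2 j hj]
  refine ⟨φ (θ j / 2), ?_, ?_⟩
  · obtain ⟨p, hp⟩ := exists_leftOf (hne i) hsi
    refine hp.of_joinedIn ?_
    have ht : Tendsto φ (𝓝[>] 0) (𝓝 (c + ρ • u i)) := by
      rw [← hφ0]; exact (hφc.tendsto 0).mono_left nhdsWithin_le_nhds
    have hIoo : ∀ᶠ τ in 𝓝[>] (0 : ℝ), τ ∈ Set.Ioo 0 (θ j) := Ioo_mem_nhdsGT hθj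
    obtain ⟨τ, h1, h2, h3⟩ := ((ht.eventually hp).and
      (hIoo.and (Ioo_mem_nhdsGT Real.pi_pos : ∀ᶠ τ in 𝓝[>] (0 : ℝ), τ ∈ Set.Ioo 0 Real.pi))).exists
    refine (h1 ?_).trans (hconn τ h2 _ hmid)
    have hcr := cross_rotate (hu i) 0 τ
    rw [rotate_zero, sub_zero] at hcr
    have : cross (u i) (φ τ - (c + ρ • u i)) = ρ * cross (u i) (rotate (u i) τ) := by
      simp only [φ, cross, PiLp.sub_apply, PiLp.add_apply, PiLp.smul_apply, smul_eq_mul]; ring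
    rw [this, hcr]
    exact mul_pos hρ0 (Real.sin_pos_of_pos_of_lt_pi h3.1 h3.2)
  · obtain ⟨p, hp⟩ := exists_leftOf (d := -u j) (by simpa using hne j)
      (hsj.mono fun p hp hpD => by
        have := hp hpD
        simp only [cross, PiLp.neg_apply] at this ⊢
        linarith)
    refine hp.of_joinedIn ?_
    have ht : Tendsto φ (𝓝[<] (θ j)) (𝓝 (c + ρ • u j)) := by
      rw [← hφj]; exact (hφc.tendsto _).mono_left nhdsWithin_le_nhds
    have hIoo : ∀ᶠ τ in 𝓝[<] (θ j), τ ∈ Set.Ioo 0 (θ j) := Ioo_mem_nhdsLT hθj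
    have hIoo' : ∀ᶠ τ in 𝓝[<] (θ j), τ ∈ Set.Ioo (θ j - Real.pi) (θ j) :=
      Ioo_mem_nhdsLT (by linarith [Real.pi_pos])
    obtain ⟨τ, h1, h2, h3⟩ := ((ht.eventually hp).and (hIoo.and hIoo')).exists
    refine (h1 ?_).trans (hconn τ h2 _ hmid)
    have hcr := cross_rotate (hu i) (θ j) τ
    rw [← hθ2 j hj] at hcr
    have : cross (-u j) (φ τ - (c + ρ • u j)) = ρ * -cross (u j) (rotate (u i) τ) := by
      simp only [φ, cross, PiLp.sub_apply, PiLp.add_apply, PiLp.smul_apply, smul_eq_mul,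
        PiLp.neg_apply]; ring
    rw [this, hcr, ← Real.sin_neg]
    exact mul_pos hρ0 (Real.sin_pos_of_pos_of_lt_pi (by linarith [h3.2]) (by linarith [h3.1]))

/-! ### Crossing parities -/

/-- The coordinate that is constant along the ray direction `(c, 1)`. -/
def shear (c : ℝ) (p : Plane) : ℝ := p 0 - c * p 1

@[fun_prop] lemma continuous_shear (c : ℝ) : Continuous (shear c) := by
  unfold shear; fun_prop

open Classical in
/-- The number modulo two of crossings of the segment `ab` with the ray that starts at `p` and has
direction `(c, 1)`. Of the two ends of the segment, the one with smaller shear coordinate counts as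
a point of the segment and the other one does not. -/
noncomputable def segmentParity (c : ℝ) (a b p : Plane) : ZMod 2 :=
  if (shear c a ≤ shear c p ∧ shear c p < shear c b ∧ cross (b - a) (p - a) < 0) ∨
    (shear c b ≤ shear c p ∧ shear c p < shear c a ∧ 0 < cross (b - a) (p - a)) then 1 else 0

open Classical in
/-- The correction at an end `a` of an arc by which the crossing parity of the arc changes when the
start of the ray moves from `p₀` to a nearby point `p`: it is one if `a` lies on the ray that
starts at `p₀` and `p` is to the left of this ray. -/
noncomputable def endCorrection (c : ℝ) (p₀ p a : Plane) : ZMod 2 :=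
  if shear c a = shear c p₀ ∧ p₀ 1 < a 1 ∧ shear c p < shear c p₀ then 1 else 0

lemma segmentParity_comm (c : ℝ) (a b p : Plane) :
    segmentParity c a b p = segmentParity c b a p := by
  have : cross (a - b) (p - b) = -cross (b - a) (p - a) := by
    simp only [cross, PiLp.sub_apply]; ring
  unfold segmentParity
  refine if_congr ?_ rfl rfl
  rw [this, neg_lt_zero, Left.neg_pos_iff, or_comm]

lemma cross_eq_shear (c : ℝ) (d e : Plane) : cross d e = shear c d * e 1 - d 1 * shear c e := by
  simp only [cross, shear]; ring

lemma shear_sub (c : ℝ) (d e : Plane) : shear c (d - e) = shear c d - shear c e := by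
  simp only [shear, PiLp.sub_apply]; ring

lemma eq_of_shear_eq {c : ℝ} {p q : Plane} (h : shear c p = shear c q) (h1 : p 1 = q 1) :
    p = q := by
  refine plane_ext ?_ h1
  simp only [shear, h1] at h; linarith

lemma mem_segment_of_cross_eq_zero {c : ℝ} {a b p : Plane} (h1 : shear c a < shear c b)
    (h2 : shear c a ≤ shear c p) (h3 : shear c p ≤ shear c b) (h : cross (b - a) (p - a) = 0) :
    p ∈ segment ℝ a b := by
  rw [cross_eq_shear c, shear_sub, shear_sub] at h
  simp only [PiLp.sub_apply] at h
  have hpos : 0 < shear c b - shear c a := by linarith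
  set t := (shear c p - shear c a) / (shear c b - shear c a) with ht
  have htm : t * (shear c b - shear c a) = shear c p - shear c a := by
    rw [ht]; field_simp
  refine ⟨1 - t, t, ?_, ?_, by ring, ?_⟩
  · rw [sub_nonneg, ht, div_le_one hpos]; linarith
  · exact div_nonneg (by linarith) hpos.le
  · have h4 : p 1 = a 1 + t * (b 1 - a 1) := by
      have : (shear c b - shear c a) * (p 1 - a 1 - t * (b 1 - a 1)) = 0 := by
        linear_combination h - (b 1 - a 1) * htm
      rcases mul_eq_zero.1 this with h | h <;> linarith
    refine eq_of_shear_eq (c := c) ?_ ?_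
    · simp only [shear, PiLp.add_apply, PiLp.smul_apply, smul_eq_mul] at htm ⊢
      linear_combination htm
    · simp only [PiLp.add_apply, PiLp.smul_apply, smul_eq_mul]
      linear_combination -h4

lemma mem_segment_of_shear_eq {c : ℝ} {a b p : Plane} (h1 : shear c a = shear c p)
    (h2 : shear c b = shear c p) (h3 : a 1 ≤ p 1) (h4 : p 1 ≤ b 1) : p ∈ segment ℝ a b := by
  rcases (h3.trans h4).eq_or_lt with h | h
  · rw [eq_of_shear_eq h1 (by linarith)]; exact left_mem_segment _ _ _
  set t := (p 1 - a 1) / (b 1 - a 1) with ht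
  have hpos : 0 < b 1 - a 1 := by linarith
  have htm : t * (b 1 - a 1) = p 1 - a 1 := by
    rw [ht]; field_simp
  refine ⟨1 - t, t, ?_, ?_, by ring, ?_⟩
  · rw [sub_nonneg, ht, div_le_one hpos]; linarith
  · exact div_nonneg (by linarith) hpos.le
  · refine eq_of_shear_eq (c := c) ?_ ?_
    · simp only [shear, PiLp.add_apply, PiLp.smul_apply, smul_eq_mul] at h1 h2 ⊢
      linear_combination t * h2 + (1 - t) * h1
    · simp only [PiLp.add_apply, PiLp.smul_apply, smul_eq_mul]
      linear_combination htm

lemma segmentParity_eventually_aux {c : ℝ} {a b p₀ : Plane} (hab : shear c a ≤ shear c b)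
    (hp₀ : p₀ ∉ segment ℝ a b) :
    ∀ᶠ p in 𝓝 p₀, segmentParity c a b p =
      segmentParity c a b p₀ + endCorrection c p₀ p a + endCorrection c p₀ p b := by
  have hsc : Continuous (shear c) := continuous_shear c
  have hcr : Continuous fun p => cross (b - a) (p - a) := by fun_prop
  have lt_near : ∀ x, shear c p₀ < x → ∀ᶠ p in 𝓝 p₀, shear c p < x := fun x hx =>
    hsc.continuousAt.eventually_lt continuousAt_const hx
  have gt_near : ∀ x, x < shear c p₀ → ∀ᶠ p in 𝓝 p₀, x < shear c p := fun x hx =>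
    continuousAt_const.eventually_lt hsc.continuousAt hx
  have neg_near : cross (b - a) (p₀ - a) < 0 → ∀ᶠ p in 𝓝 p₀, cross (b - a) (p - a) < 0 := fun h =>
    hcr.continuousAt.eventually_lt continuousAt_const h
  have pos_near : 0 < cross (b - a) (p₀ - a) → ∀ᶠ p in 𝓝 p₀, 0 < cross (b - a) (p - a) := fun h =>
    continuousAt_const.eventually_lt hcr.continuousAt h
  have hcross : cross (b - a) (p₀ - a) =
      (shear c b - shear c a) * (p₀ 1 - a 1) - (b 1 - a 1) * (shear c p₀ - shear c a) := by
    rw [cross_eq_shear c, shear_sub, shear_sub]; rfl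
  have two : (1 : ZMod 2) + 1 = 0 := by decide
  unfold segmentParity endCorrection
  rcases hab.eq_or_lt with hab | hab
  · -- both ends have the same shear coordinate: they are on the same side of `p₀` if on its line
    refine Eventually.of_forall fun p => ?_
    rw [if_neg (by intro h; rcases h with h | h <;> linarith [h.1, h.2.1]),
      if_neg (by intro h; rcases h with h | h <;> linarith [h.1, h.2.1]), ← hab]
    by_cases hx : shear c a = shear c p₀
    · have : p₀ 1 < a 1 ↔ p₀ 1 < b 1 := by
        constructor
        · intro h; by_contra h'; push Not at h'
          refine hp₀ ?_
          rw [segment_symm]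
          exact mem_segment_of_shear_eq (hab ▸ hx) hx h' h.le
        · intro h; by_contra h'; push Not at h'
          exact hp₀ (mem_segment_of_shear_eq hx (hab ▸ hx) h' h.le)
      simp only [this]
      split_ifs <;> simp [two]
    · simp [hx]
  have hne : shear c a ≤ shear c p₀ → shear c p₀ ≤ shear c b → cross (b - a) (p₀ - a) ≠ 0 :=
    fun h1 h2 h => hp₀ (mem_segment_of_cross_eq_zero hab h1 h2 h)
  rcases lt_trichotomy (shear c a) (shear c p₀) with h1 | h1 | h1
  · rcases lt_trichotomy (shear c p₀) (shear c b) with h2 | h2 | h2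
    · rcases lt_or_gt_of_ne (hne h1.le h2.le) with h3 | h3
      · filter_upwards [gt_near _ h1, lt_near _ h2, neg_near h3] with p g1 g2 g3
        simp [g1.le, g2, g3, h1.le, h2, h3, h1.ne, h2.ne']
      · filter_upwards [gt_near _ h1, lt_near _ h2, pos_near h3] with p g1 g2 g3
        simp [g2, g3, h1.le, h2, h3, h1.ne, h2.ne', not_lt.2 g3.le, not_lt.2 h3.le, not_lt.2 g1.le,
          not_lt.2 h1.le]
    · have e : cross (b - a) (p₀ - a) = (shear c b - shear c a) * (p₀ 1 - b 1) := by
        rw [hcross, h2]; ring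
      rcases lt_or_gt_of_ne (hne h1.le h2.le) with h3 | h3
      · have h4 : p₀ 1 < b 1 := by nlinarith
        filter_upwards [gt_near _ h1, neg_near h3] with p g1 g3
        simp [g1.le, g3, h1.ne, ← h2, h4, not_lt.2 g1.le, not_lt.2 h1.le]
      · have h4 : ¬ p₀ 1 < b 1 := by nlinarith
        filter_upwards [gt_near _ h1, pos_near h3] with p g1 g3
        simp [g3, h1.ne, ← h2, h4, not_lt.2 g1.le, not_lt.2 h1.le, not_lt.2 g3.le]
    · filter_upwards [gt_near _ h1, gt_near _ h2] with p g1 g2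
      simp [h1.ne, h2.ne, not_lt.2 g1.le, not_lt.2 h1.le, not_lt.2 g2.le, not_lt.2 h2.le]
  · have h2 : shear c p₀ < shear c b := h1 ▸ hab
    have e : cross (b - a) (p₀ - a) = (shear c b - shear c a) * (p₀ 1 - a 1) := by
      rw [hcross, h1]; ring
    rcases lt_or_gt_of_ne (hne h1.le h2.le) with h3 | h3
    · have h4 : p₀ 1 < a 1 := by nlinarith
      filter_upwards [lt_near _ h2, neg_near h3] with p g2 g3
      by_cases g1 : shear c p < shear c p₀
      · simp [h1, h2, h2.ne', h3, h4, g1, not_le.2 g1, not_le.2 g2, two]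
      · simp [h1, h2, h2.ne', h3, h4, g1, not_lt.1 g1, g2, g3]
    · have h4 : ¬ p₀ 1 < a 1 := by nlinarith
      filter_upwards [lt_near _ h2, pos_near h3] with p g2 g3
      simp [h1, h2.ne', h4, not_le.2 g2, not_le.2 h2, not_lt.2 g3.le, not_lt.2 h3.le]
  · have h2 : shear c p₀ < shear c b := h1.trans hab
    filter_upwards [lt_near _ h1, lt_near _ h2] with p g1 g2
    simp [h1.ne', h2.ne', not_le.2 g1, not_le.2 h1, not_le.2 g2, not_le.2 h2]

/-- Off the segment, its crossing parity is locally constant up to corrections at the ends. -/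
lemma segmentParity_eventually {c : ℝ} {a b p₀ : Plane} (hp₀ : p₀ ∉ segment ℝ a b) :
    ∀ᶠ p in 𝓝 p₀, segmentParity c a b p =
      segmentParity c a b p₀ + endCorrection c p₀ p a + endCorrection c p₀ p b := by
  rcases le_total (shear c a) (shear c b) with h | h
  · exact segmentParity_eventually_aux h hp₀
  · rw [segment_symm] at hp₀
    filter_upwards [segmentParity_eventually_aux h hp₀] with p hp
    rw [segmentParity_comm c a b, segmentParity_comm c a b, hp]; ring

/-- The direction of the rays. -/
def rayDir (c : ℝ) : Plane := !₂[c, 1]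

@[simp] lemma rayDir_zero (c : ℝ) : rayDir c 0 = c := rfl
@[simp] lemma rayDir_one (c : ℝ) : rayDir c 1 = 1 := rfl

lemma shear_add_smul_rayDir (c s : ℝ) (q : Plane) : shear c (q + s • rayDir c) = shear c q := by
  simp [shear]; ring

lemma endCorrection_eq_zero {c : ℝ} {p₀ p : Plane} (h : shear c p = shear c p₀) (a : Plane) :
    endCorrection c p₀ p a = 0 := by
  simp [endCorrection, h]

/-- Exactly one of the rays that start right above and right below an interior point of a segment
crosses the segment. -/
lemma segmentParity_add_eq_one {c : ℝ} {a b q : Plane} (hab : shear c a ≠ shear c b)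
    (hq : q ∈ openSegment ℝ a b) {s : ℝ} (hs : 0 < s) :
    segmentParity c a b (q + s • rayDir c) + segmentParity c a b (q - s • rayDir c) = 1 := by
  wlog h : shear c a < shear c b generalizing a b
  · rw [segmentParity_comm c a b, segmentParity_comm c a b]
    exact this hab.symm (openSegment_symm ℝ a b ▸ hq) (lt_of_le_of_ne (not_lt.1 h) hab.symm)
  rw [sub_eq_add_neg, ← neg_smul]
  obtain ⟨x, y, hx, hy, hxy, rfl⟩ := hq
  set q := x • a + y • b with hq
  have hcr : ∀ t : ℝ, cross (b - a) (q + t • rayDir c - a) = t * (shear c b - shear c a) := by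
    intro t
    simp only [cross, shear, hq, PiLp.sub_apply, PiLp.add_apply, PiLp.smul_apply, smul_eq_mul,
      rayDir_zero, rayDir_one]
    linear_combination ((b 0 - a 0) * a 1 - (b 1 - a 1) * a 0) * hxy
  have hsq : shear c q = shear c a + y * (shear c b - shear c a) := by
    simp only [shear, hq, PiLp.add_apply, PiLp.smul_apply, smul_eq_mul]
    linear_combination (a 0 - c * a 1) * hxy
  have hp : 0 < shear c b - shear c a := by linarith
  have h1 : shear c a < shear c q := by rw [hsq]; nlinarith [mul_pos hy hp]
  have h2 : shear c q < shear c b := by rw [hsq]; nlinarith [mul_pos hx hp]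
  unfold segmentParity
  simp only [hcr, shear_add_smul_rayDir]
  have h3 := mul_pos hs hp
  simp [h1.le, h2, not_lt.2 h1.le, not_lt.2 h3.le, h3]

/-! ### Germs of segments at a point -/

lemma isClosed_segment (a b : Plane) : IsClosed (segment ℝ a b) := by
  rw [segment_eq_image_lineMap]
  exact (isCompact_Icc.image AffineMap.lineMap_continuous).isClosed

lemma cross_self_smul (a b : ℝ) (d : Plane) : cross (a • d) (b • d) = 0 := by
  simp [cross]; ring

lemma mem_segment_iff_smul {c z p : Plane} :
    p ∈ segment ℝ c z ↔ ∃ t : ℝ, 0 ≤ t ∧ t ≤ 1 ∧ p = c + t • (z - c) := by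
  rw [segment_eq_image']
  constructor
  · rintro ⟨t, ⟨h0, h1⟩, rfl⟩; exact ⟨t, h0, h1, rfl⟩
  · rintro ⟨t, h0, h1, rfl⟩; exact ⟨t, ⟨h0, h1⟩, rfl⟩

lemma mem_openSegment_iff_smul {c z p : Plane} :
    p ∈ openSegment ℝ c z ↔ ∃ t : ℝ, 0 < t ∧ t < 1 ∧ p = c + t • (z - c) := by
  rw [openSegment_eq_image']
  constructor
  · rintro ⟨t, ⟨h0, h1⟩, rfl⟩; exact ⟨t, h0, h1, rfl⟩
  · rintro ⟨t, h0, h1, rfl⟩; exact ⟨t, ⟨h0, h1⟩, rfl⟩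

lemma cross_eq_zero_of_mem_segment (k : ℝ) {c z x y : Plane} (hx : x ∈ segment ℝ c z)
    (hy : y ∈ segment ℝ c z) : cross (k • (z - c)) (x - y) = 0 := by
  obtain ⟨t, -, -, rfl⟩ := mem_segment_iff_smul.1 hx
  obtain ⟨s, -, -, rfl⟩ := mem_segment_iff_smul.1 hy
  rw [show c + t • (z - c) - (c + s • (z - c)) = (t - s) • (z - c) by module, cross_self_smul]

/-- Along a segment without further branches, the face on either side does not change. -/
lemma sameFace_segment {D : Set Plane} {a b q q' : Plane} {k : ℝ} (hab : b ≠ a) (hk : k ≠ 0)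
    (h : ∀ q ∈ openSegment ℝ a b, ∀ᶠ p in 𝓝 q, p ∈ D → p ∈ segment ℝ a b)
    (hq : q ∈ openSegment ℝ a b) (hq' : q' ∈ openSegment ℝ a b) :
    SameFace D q (k • (b - a)) q' (k • (b - a)) :=
  sameFace_of_mem_openSegment (smul_ne_zero hk (sub_ne_zero.2 hab))
    (fun _ hx _ hy => cross_eq_zero_of_mem_segment k hx hy) h hq hq'

/-- Several segments leave `c`, meet only in `c`, and contain `D` near `c`. The face to the left of
one of them is the face to the right of another one. -/
lemma exists_sameFace_of_segments {ι : Type*} [Finite ι] {D : Set Plane} {c : Plane}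
    {z : ι → Plane} (hz : ∀ i, z i ≠ c)
    (hmeet : ∀ i j, i ≠ j → segment ℝ c (z i) ∩ segment ℝ c (z j) ⊆ {c})
    (hD : ∀ᶠ p in 𝓝 c, p ∈ D → ∃ i, p ∈ segment ℝ c (z i))
    (hsep : ∀ i, ∀ q ∈ openSegment ℝ c (z i), ∀ᶠ p in 𝓝 q, p ∈ D → p ∈ segment ℝ c (z i))
    (i : ι) (hi : ∃ j, j ≠ i) :
    ∃ j, j ≠ i ∧ ∀ q ∈ openSegment ℝ c (z i), ∀ q' ∈ openSegment ℝ c (z j),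
      SameFace D q (z i - c) q' (c - z j) := by
  have hn : ∀ i, 0 < ‖z i - c‖ := fun i => norm_pos_iff.2 (sub_ne_zero.2 (hz i))
  set u : ι → Plane := fun i => ‖z i - c‖⁻¹ • (z i - c) with hu
  have hzu : ∀ i, z i - c = ‖z i - c‖ • u i := fun i => by
    rw [hu, smul_smul, mul_inv_cancel₀ (hn i).ne', one_smul]
  have hunit : ∀ i, u i 0 ^ 2 + u i 1 ^ 2 = 1 := by
    intro i
    have : ‖u i‖ = 1 := by
      rw [hu, norm_smul, norm_inv, norm_norm, inv_mul_cancel₀ (hn i).ne']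
    rw [EuclideanSpace.norm_eq, Real.sqrt_eq_one, Fin.sum_univ_two] at this
    simpa using this
  have hmem : ∀ i, ∀ ρ : ℝ, 0 < ρ → ρ < ‖z i - c‖ → c + ρ • u i ∈ openSegment ℝ c (z i) := by
    intro i ρ h0 h1
    refine mem_openSegment_iff_smul.2 ⟨ρ * ‖z i - c‖⁻¹, by have := hn i; positivity, ?_, ?_⟩
    · rw [← div_eq_mul_inv, div_lt_one (hn i)]; exact h1
    · rw [hu, smul_smul]
  have hev : ∀ i, ∀ᶠ ρ : ℝ in 𝓝[>] 0, c + ρ • u i ∈ openSegment ℝ c (z i) := by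
    intro i
    filter_upwards [Ioo_mem_nhdsGT (hn i)] with ρ hρ
    exact hmem i ρ hρ.1 hρ.2
  have hu0 : ∀ i, u i ≠ 0 := fun i h => by simpa [h] using hunit i
  have hinj : Function.Injective u := by
    intro i j hij
    by_contra hne
    obtain ⟨ρ, h1, h2, h3⟩ := ((hev i).and ((hev j).and self_mem_nhdsWithin)).exists
    have h3 : (0 : ℝ) < ρ := h3
    have := hmeet i j hne ⟨openSegment_subset_segment _ _ _ h1,
      openSegment_subset_segment _ _ _ (hij ▸ h2)⟩
    simp [h3.ne', hu0] at this
  obtain ⟨j, hj, hev'⟩ := exists_sameFace_of_rays (D := D) (c := c) hunit hinj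
    (hD.mono fun p hp hpD => by
      obtain ⟨k, hk⟩ := hp hpD
      obtain ⟨t, h0, -, rfl⟩ := mem_segment_iff_smul.1 hk
      refine ⟨k, t * ‖z k - c‖, by positivity, ?_⟩
      rw [mul_smul, ← hzu])
    (fun k => (hev k).mono fun ρ hρ => (hsep k _ hρ).mono fun p hp hpD =>
      cross_eq_zero_of_mem_segment _ (hp hpD) (openSegment_subset_segment _ _ _ hρ)) i hi
  refine ⟨j, hj, fun q hq q' hq' => ?_⟩
  obtain ⟨ρ, h1, h2, h3⟩ := (hev'.and ((hev i).and (hev j))).exists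
  have h1 := h1.smul (hn i) (hn j)
  rw [smul_neg, ← hzu, ← hzu, neg_sub] at h1
  have e1 := sameFace_segment (hz i) one_ne_zero (hsep i) hq h2
  have e2 := sameFace_segment (hz j) (neg_ne_zero.2 one_ne_zero) (hsep j) h3 hq'
  rw [one_smul] at e1
  rw [neg_one_smul, neg_sub] at e2
  exact (e1.trans (sub_ne_zero.2 (hz i)) h1).trans (sub_ne_zero.2 (hz j).symm) e2

/-! ### Polygonal arcs -/

/-- Near `x`, the arc `A` with ends `x` and `y` is the segment `xz`, and so it is near the interior
points of this segment. -/
structure IsEndSegment (A : Set Plane) (x y z : Plane) : Prop where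
  ne : z ≠ x
  subset : segment ℝ x z ⊆ A
  not_mem : y ∉ openSegment ℝ x z
  near_end : ∀ᶠ p in 𝓝 x, p ∈ A → p ∈ segment ℝ x z
  near : ∀ q ∈ openSegment ℝ x z, ∀ᶠ p in 𝓝 q, p ∈ A → p ∈ segment ℝ x z

/-- The set `D` has no branches at points of the arc `A` other than its ends `x` and `y`. -/
def IsUnbranched (D A : Set Plane) (x y : Plane) : Prop :=
  ∀ p ∈ A, p ≠ x → p ≠ y → ∀ᶠ p' in 𝓝 p, p' ∈ D → p' ∈ A

lemma IsUnbranched.symm {D A : Set Plane} {x y : Plane} (h : IsUnbranched D A x y) :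
    IsUnbranched D A y x := fun p hp h1 h2 => h p hp h2 h1

lemma _root_.IsPolygonalArc.isClosed {x y : Plane} {A : Set Plane} (h : IsPolygonalArc x y A) :
    IsClosed A := by
  induction h with
  | single => exact isClosed_segment _ _
  | cons _ _ _ ih => exact (isClosed_segment _ _).union ih

lemma _root_.IsPolygonalArc.left_mem {x y : Plane} {A : Set Plane} (h : IsPolygonalArc x y A) :
    x ∈ A := by
  induction h with
  | single => exact left_mem_segment _ _ _
  | cons _ _ _ ih => exact Or.inl (left_mem_segment _ _ _)

lemma _root_.IsPolygonalArc.right_mem {x y : Plane} {A : Set Plane} (h : IsPolygonalArc x y A) :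
    y ∈ A := by
  induction h with
  | single => exact right_mem_segment _ _ _
  | cons _ _ _ ih => exact Or.inr ih

lemma _root_.IsPolygonalArc.ne {x y : Plane} {A : Set Plane} (h : IsPolygonalArc x y A) :
    x ≠ y := by
  induction h with
  | single h => exact h
  | @cons x y z A hxy hA hmeet ih =>
    rintro rfl
    exact hxy (hmeet.subset ⟨left_mem_segment _ _ _, hA.right_mem⟩)

lemma eventually_not_mem {A : Set Plane} (hA : IsClosed A) {p : Plane} (hp : p ∉ A) :
    ∀ᶠ p' in 𝓝 p, p' ∉ A := hA.isOpen_compl.mem_nhds hp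

lemma left_notMem_openSegment {x z : Plane} (h : z ≠ x) : x ∉ openSegment ℝ x z := by
  intro hx
  obtain ⟨t, h0, -, ht⟩ := mem_openSegment_iff_smul.1 hx
  have : t • (z - x) = 0 := by simpa using ht.symm
  rcases smul_eq_zero.1 this with h' | h'
  · exact h0.ne' h'
  · exact h (sub_eq_zero.1 h')

lemma IsEndSegment.near_of_isUnbranched {D A : Set Plane} {x y z : Plane}
    (h : IsEndSegment A x y z) (hD : IsUnbranched D A x y) :
    ∀ q ∈ openSegment ℝ x z, ∀ᶠ p in 𝓝 q, p ∈ D → p ∈ segment ℝ x z := by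
  intro q hq
  have hqA := h.subset (openSegment_subset_segment _ _ _ hq)
  have hqx : q ≠ x := fun e => left_notMem_openSegment h.ne (e ▸ hq)
  have hqy : q ≠ y := fun e => h.not_mem (e ▸ hq)
  filter_upwards [h.near q hq, hD q hqA hqx hqy] with p h1 h2 h3
  exact h1 (h2 h3)

/-- Two end segments of an arc at the same end point in the same direction. -/
lemma IsEndSegment.sameFace {D A : Set Plane} {x y z z' q q' : Plane}
    (h : IsEndSegment A x y z) (h' : IsEndSegment A x y z') (hD : IsUnbranched D A x y)
    {k : ℝ} (hk : k ≠ 0) (hq : q ∈ openSegment ℝ x z) (hq' : q' ∈ openSegment ℝ x z') :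
    SameFace D q (k • (z - x)) q' (k • (z' - x)) := by
  have ht : Tendsto (fun t : ℝ => x + t • (z' - x)) (𝓝[>] 0) (𝓝 x) := by
    have : Continuous (fun t : ℝ => x + t • (z' - x)) := by fun_prop
    simpa using (this.tendsto 0).mono_left nhdsWithin_le_nhds
  have h01 : ∀ᶠ t in 𝓝[>] (0 : ℝ), t ∈ Set.Ioo (0 : ℝ) 1 := Ioo_mem_nhdsGT one_pos
  obtain ⟨t, h1, h2, h3⟩ := ((ht.eventually h.near_end).and h01).exists
  have hp' : x + t • (z' - x) ∈ openSegment ℝ x z' := mem_openSegment_iff_smul.2 ⟨t, h2, h3, rfl⟩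
  obtain ⟨s, hs0, hs1, hs⟩ :=
    mem_segment_iff_smul.1 (h1 (h'.subset (openSegment_subset_segment _ _ _ hp')))
  have hs' : t • (z' - x) = s • (z - x) := by simpa using hs
  have hspos : 0 < s := by
    refine lt_of_le_of_ne hs0 fun e => ?_
    rw [← e, zero_smul] at hs'
    exact smul_ne_zero h2.ne' (sub_ne_zero.2 h'.ne) hs'
  have hp : x + (s / 2) • (z - x) ∈ openSegment ℝ x z :=
    mem_openSegment_iff_smul.2 ⟨s / 2, by linarith, by linarith, rfl⟩
  have hpp : x + (s / 2) • (z - x) ∈ openSegment ℝ x z' := by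
    refine mem_openSegment_iff_smul.2 ⟨t / 2, by linarith, by linarith, ?_⟩
    rw [show (s / 2) • (z - x) = (1 / 2 : ℝ) • (s • (z - x)) by module, ← hs']; module
  have e1 := sameFace_segment h.ne hk (h.near_of_isUnbranched hD) hq hp
  have e2 := sameFace_segment h'.ne hk (h'.near_of_isUnbranched hD) hpp hq'
  have e3 : k • (z - x) = (t / s) • (k • (z' - x)) := by
    rw [show (t / s) • (k • (z' - x)) = (k / s) • (t • (z' - x)) by module, hs', smul_smul,
      div_mul_cancel₀ _ hspos.ne']
  have e2' := e2.smul (div_pos h2 hspos) (one_pos)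
  rw [← e3, one_smul] at e2'
  exact e1.trans (smul_ne_zero hk (sub_ne_zero.2 h.ne)) e2'

/-- The face to the left of a path that goes straight from `x` to `y` and then straight to `z` does
not change at the bend `y`. -/
lemma sameFace_bend {D : Set Plane} {x y z : Plane} (hxy : x ≠ y) (hzy : z ≠ y)
    (hmeet : segment ℝ y x ∩ segment ℝ y z ⊆ {y})
    (hD : ∀ᶠ p in 𝓝 y, p ∈ D → p ∈ segment ℝ y x ∨ p ∈ segment ℝ y z)
    (h1 : ∀ q ∈ openSegment ℝ y x, ∀ᶠ p in 𝓝 q, p ∈ D → p ∈ segment ℝ y x)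
    (h2 : ∀ q ∈ openSegment ℝ y z, ∀ᶠ p in 𝓝 q, p ∈ D → p ∈ segment ℝ y z)
    {q q' : Plane} (hq : q ∈ openSegment ℝ y x) (hq' : q' ∈ openSegment ℝ y z) :
    SameFace D q (y - x) q' (z - y) := by
  obtain ⟨j, hj, H⟩ := exists_sameFace_of_segments (D := D) (c := y)
    (z := fun b : Bool => if b then z else x) (by simp [hxy, hzy])
    (by
      intro i j hij
      cases i <;> cases j <;> simp at hij ⊢
      · simpa using hmeet
      · exact fun p h h' => hmeet ⟨h', h⟩)
    (hD.mono fun p hp hpD => by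
      rcases hp hpD with h | h
      · exact ⟨false, by simpa using h⟩
      · exact ⟨true, by simpa using h⟩)
    (by intro i; cases i <;> simpa) true ⟨false, by simp⟩
  obtain rfl : j = false := by simpa using hj
  exact (H q' (by simpa using hq') q (by simpa using hq)).symm

/-- What is used about a polygonal arc: its first and last segments lie along the same faces, on
both sides, and it has a crossing parity, which is locally constant off the arc up to corrections at
the ends and which jumps at the first segment. -/
lemma _root_.IsPolygonalArc.exists_ends {x y : Plane} {A : Set Plane} (h : IsPolygonalArc x y A) :
    ∃ z z', IsEndSegment A x y z ∧ IsEndSegment A y x z' ∧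
      (∀ D, IsUnbranched D A x y → ∀ q ∈ openSegment ℝ x z, ∀ q' ∈ openSegment ℝ y z',
        SameFace D q (z - x) q' (y - z') ∧ SameFace D q (x - z) q' (z' - y)) ∧
      ∃ S : Set ℝ, S.Finite ∧ ∀ c ∉ S, shear c x ≠ shear c z ∧ ∃ χ : Plane → ZMod 2,
        (∀ p₀ ∉ A, ∀ᶠ p in 𝓝 p₀,
          χ p = χ p₀ + endCorrection c p₀ p x + endCorrection c p₀ p y) ∧
        ∀ q ∈ openSegment ℝ x z, ∀ᶠ s : ℝ in 𝓝[>] 0,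
          χ (q + s • rayDir c) + χ (q - s • rayDir c) = 1 := by
  have hS : ∀ x y : Plane, x ≠ y →
      ∃ S : Set ℝ, S.Finite ∧ ∀ c ∉ S, shear c x ≠ shear c y := by
    intro x y hxy
    refine ⟨{c | shear c x = shear c y}, Set.Subsingleton.finite ?_, fun c hc => hc⟩
    intro c hc c' hc'
    simp only [shear, Set.mem_ofPred_eq] at hc hc'
    have h1 : (c - c') * (x 1 - y 1) = 0 := by linarith
    rcases mul_eq_zero.1 h1 with h | h
    · linarith
    · have h' : x 1 = y 1 := by linarith
      exact absurd (plane_ext (by rw [h'] at hc; linarith) h') hxy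
  induction h with
  | @single x y hxy =>
    have e1 : IsEndSegment (segment ℝ x y) x y y :=
      ⟨hxy.symm, subset_rfl, fun h => left_notMem_openSegment hxy (openSegment_symm ℝ x y ▸ h),
        Eventually.of_forall fun _ => id, fun _ _ => Eventually.of_forall fun _ => id⟩
    have e2 : IsEndSegment (segment ℝ x y) y x x :=
      ⟨hxy, (segment_symm ℝ y x).subset,
        fun h => left_notMem_openSegment hxy.symm (openSegment_symm ℝ x y ▸ h),
        by rw [segment_symm]; exact Eventually.of_forall fun _ => id,
        fun _ _ => by rw [segment_symm]; exact Eventually.of_forall fun _ => id⟩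
    refine ⟨y, x, e1, e2, fun D hD q hq q' hq' => ?_, ?_⟩
    · rw [openSegment_symm] at hq'
      have s1 := sameFace_segment e1.ne one_ne_zero (e1.near_of_isUnbranched hD) hq hq'
      have s2 := sameFace_segment e1.ne (neg_ne_zero.2 one_ne_zero)
        (e1.near_of_isUnbranched hD) hq hq'
      rw [one_smul] at s1
      rw [neg_one_smul, neg_sub] at s2
      exact ⟨s1, s2⟩
    · obtain ⟨S, hSf, hS⟩ := hS x y hxy
      refine ⟨S, hSf, fun c hc => ⟨hS c hc, segmentParity c x y,
        fun p₀ hp₀ => segmentParity_eventually hp₀, fun q hq => ?_⟩⟩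
      filter_upwards [self_mem_nhdsWithin] with s hs
      exact segmentParity_add_eq_one (hS c hc) hq hs
  | @cons x y w A hxy hA hmeet ih =>
    obtain ⟨z, z', hz, hz', hface, S, hSf, hpar⟩ := ih
    have hxA : x ∉ A := fun h => hxy (hmeet.subset ⟨left_mem_segment _ _ _, h⟩)
    have hws : w ∉ segment ℝ x y := fun h => hA.ne (hmeet.subset ⟨h, hA.right_mem⟩).symm
    have hopen : ∀ q ∈ openSegment ℝ x y, q ∉ A := fun q hq h => by
      have : q = y := hmeet.subset ⟨openSegment_subset_segment _ _ _ hq, h⟩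
      subst this
      rw [openSegment_symm] at hq
      exact left_notMem_openSegment hxy hq
    have e1 : IsEndSegment (segment ℝ x y ∪ A) x w y := by
      refine ⟨hxy.symm, Set.subset_union_left, fun h => hws (openSegment_subset_segment _ _ _ h),
        ?_, fun q hq => ?_⟩
      · filter_upwards [eventually_not_mem hA.isClosed hxA] with p hp hp'
        exact hp'.resolve_right hp
      · filter_upwards [eventually_not_mem hA.isClosed (hopen q hq)] with p hp hp'
        exact hp'.resolve_right hp
    have e2 : IsEndSegment (segment ℝ x y ∪ A) w x z' := by
      refine ⟨hz'.ne, hz'.subset.trans Set.subset_union_right,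
        fun h => hxA (hz'.subset (openSegment_subset_segment _ _ _ h)), ?_, fun q hq => ?_⟩
      · filter_upwards [eventually_not_mem (isClosed_segment x y) hws, hz'.near_end] with p h1 h2 h3
        exact h2 (h3.resolve_left h1)
      · have hqs : q ∉ segment ℝ x y := fun h => by
          have : q = y :=
            hmeet.subset ⟨h, hz'.subset (openSegment_subset_segment _ _ _ hq)⟩
          exact hz'.not_mem (this ▸ hq)
        filter_upwards [eventually_not_mem (isClosed_segment x y) hqs, hz'.near q hq]
          with p h1 h2 h3
        exact h2 (h3.resolve_left h1)
    refine ⟨y, z', e1, e2, fun D hD q hq q' hq' => ?_, ?_⟩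
    · have hDA : IsUnbranched D A y w := by
        intro p hp h1 h2
        have hps : p ∉ segment ℝ x y := fun h => h1 (hmeet.subset ⟨h, hp⟩)
        filter_upwards [hD p (Or.inr hp) (fun e => hxA (e ▸ hp)) h2,
          eventually_not_mem (isClosed_segment x y) hps] with p' h3 h4 h5
        exact (h3 h5).resolve_left h4
      have hyD : ∀ᶠ p in 𝓝 y, p ∈ D → p ∈ segment ℝ y x ∨ p ∈ segment ℝ y z := by
        filter_upwards [hD y (Or.inr hA.left_mem) hxy.symm hA.ne, hz.near_end] with p h1 h2 h3
        rw [segment_symm]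
        exact (h1 h3).imp_right h2
      have hsub : segment ℝ y x ∩ segment ℝ y z ⊆ {y} := by
        rw [segment_symm ℝ y x, ← hmeet]
        exact Set.inter_subset_inter_right _ hz.subset
      have n1 := e1.near_of_isUnbranched hD
      have n2 := hz.near_of_isUnbranched hDA
      rw [openSegment_symm, segment_symm] at n1
      have hm : ∃ m, m ∈ openSegment ℝ y z :=
        ⟨_, mem_openSegment_iff_smul.2 ⟨1 / 2, by norm_num, by norm_num, rfl⟩⟩
      obtain ⟨m, hm⟩ := hm
      rw [openSegment_symm] at hq
      have b1 := sameFace_bend hxy hz.ne hsub hyD n1 n2 hq hm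
      have b2 := (sameFace_bend hz.ne hxy (Set.inter_comm _ _ ▸ hsub)
        (hyD.mono fun p h h' => (h h').symm) n2 n1 hm hq).symm
      obtain ⟨f1, f2⟩ := hface D hDA m hm q' hq'
      exact ⟨b1.trans (sub_ne_zero.2 hz.ne) f1, b2.trans (sub_ne_zero.2 hz.ne.symm) f2⟩
    · obtain ⟨S', hSf', hS'⟩ := hS x y hxy
      refine ⟨S ∪ S', hSf.union hSf', fun c hc => ⟨hS' c fun h => hc (Or.inr h), ?_⟩⟩
      obtain ⟨-, χ, hχ, -⟩ := hpar c fun h => hc (Or.inl h)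
      refine ⟨fun p => segmentParity c x y p + χ p, fun p₀ hp₀ => ?_, fun q hq => ?_⟩
      · filter_upwards [hχ p₀ fun h => hp₀ (Or.inr h),
          segmentParity_eventually (c := c) fun h => hp₀ (Or.inl h)] with p h1 h2
        rw [h1, h2]
        linear_combination CharTwo.add_self_eq_zero (endCorrection c p₀ p y)
      · have hnear := hχ q (hopen q hq)
        have t1 : Tendsto (fun s : ℝ => q + s • rayDir c) (𝓝[>] 0) (𝓝 q) := by
          have : Continuous (fun s : ℝ => q + s • rayDir c) := by fun_prop
          simpa using (this.tendsto 0).mono_left nhdsWithin_le_nhds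
        have t2 : Tendsto (fun s : ℝ => q - s • rayDir c) (𝓝[>] 0) (𝓝 q) := by
          have : Continuous (fun s : ℝ => q - s • rayDir c) := by fun_prop
          simpa using (this.tendsto 0).mono_left nhdsWithin_le_nhds
        filter_upwards [t1.eventually hnear, t2.eventually hnear, self_mem_nhdsWithin]
          with s h1 h2 hs
        have hsh : shear c (q - s • rayDir c) = shear c q := by
          rw [sub_eq_add_neg, ← neg_smul, shear_add_smul_rayDir]
        have h3 := segmentParity_add_eq_one (hS' c fun h => hc (Or.inr h)) hq hs
        rw [h1, h2]
        simp only [endCorrection_eq_zero (shear_add_smul_rayDir c s q), endCorrection_eq_zero hsh]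
        linear_combination h3 + CharTwo.add_self_eq_zero (χ q)

/-! ### The edge bound for plane graphs -/

section EdgeBound

variable {V : Type*} [Fintype V] {G : SimpleGraph V} [Fintype G.edgeSet]

open Classical in
/-- The boundary of a set of edges modulo two: it counts, at each vertex, the edges of the set. Its
kernel is the cycle space. -/
noncomputable def boundary (G : SimpleGraph V) [Fintype G.edgeSet] :
    (G.edgeSet → ZMod 2) →ₗ[ZMod 2] (V → ZMod 2) where
  toFun C v := ∑ e : G.edgeSet, if v ∈ e.1 then C e else 0
  map_add' C C' := by
    ext v
    simp only [Pi.add_apply, ← Finset.sum_add_distrib]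
    exact Finset.sum_congr rfl fun e _ => by split_ifs <;> simp
  map_smul' k C := by
    ext v
    simp only [Pi.smul_apply, smul_eq_mul, Finset.mul_sum, RingHom.id_apply]
    exact Finset.sum_congr rfl fun e _ => by split_ifs <;> simp

/-- Summation by parts. The map `o` chooses an orientation of every edge. -/
lemma sum_mul_boundary (C : G.edgeSet → ZMod 2) (h : V → ZMod 2) (o : G.edgeSet → G.Dart)
    (ho : ∀ e, (o e).edge = e) :
    ∑ v, h v * boundary G C v = ∑ e, C e * (h (o e).fst + h (o e).snd) := by
  classical
  simp only [boundary, LinearMap.coe_mk, AddHom.coe_mk, Finset.mul_sum]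
  rw [Finset.sum_comm]
  refine Finset.sum_congr rfl fun e _ => ?_
  have he : e.1 = s((o e).fst, (o e).snd) := (ho e).symm
  have hne : (o e).fst ≠ (o e).snd := (o e).adj.ne
  have : ∀ v, h v * (if v ∈ e.1 then C e else 0) =
      (if v = (o e).fst then C e * h v else 0) + (if v = (o e).snd then C e * h v else 0) := by
    intro v
    rw [he]
    simp only [Sym2.mem_iff]
    by_cases h1 : v = (o e).fst
    · have h2 : v ≠ (o e).snd := h1 ▸ hne
      simp [h1, hne, mul_comm]
    · by_cases h2 : v = (o e).snd <;> simp [h1, h2, hne.symm, mul_comm]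
  rw [Finset.sum_congr rfl fun v _ => this v, Finset.sum_add_distrib]
  simp [mul_add]

/-- The cycle space has dimension at least `|E| - |V| + 1`, as boundaries have sum zero. -/
lemma card_edgeSet_le_finrank_ker [Nonempty V] :
    Fintype.card G.edgeSet + 1 ≤
      Module.finrank (ZMod 2) (LinearMap.ker (boundary G)) + Fintype.card V := by
  classical
  let σ : (V → ZMod 2) →ₗ[ZMod 2] ZMod 2 := ∑ v, LinearMap.proj v
  have hσ : ∀ f, σ f = ∑ v, f v := fun f => by simp [σ]
  have hσs : LinearMap.range σ = ⊤ := by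
    rw [LinearMap.range_eq_top]
    intro k
    obtain ⟨v⟩ := ‹Nonempty V›
    exact ⟨Pi.single v k, by rw [hσ]; simp⟩
  have h1 := LinearMap.finrank_range_add_finrank_ker σ
  rw [hσs, finrank_top, Module.finrank_self, Module.finrank_fintype_fun_eq_card] at h1
  have h2 := LinearMap.finrank_range_add_finrank_ker (boundary G)
  rw [Module.finrank_fintype_fun_eq_card] at h2
  have hle : LinearMap.range (boundary G) ≤ LinearMap.ker σ := by
    rintro _ ⟨C, rfl⟩
    rw [LinearMap.mem_ker, hσ]
    have ho : ∀ e : G.edgeSet, ∃ d : G.Dart, d.edge = e := by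
      rintro ⟨e, he⟩
      induction e with
      | h a b => exact ⟨⟨(a, b), he⟩, rfl⟩
    choose o ho using ho
    have := sum_mul_boundary C (fun _ => 1) o ho
    simp only [one_mul] at this
    rw [this]
    exact Finset.sum_eq_zero fun e _ => by rw [CharTwo.add_self_eq_zero, mul_zero]
  have h3 := Submodule.finrank_mono hle
  omega

/-- An algebraic form of Euler's formula. Every dart `d` has a side, and `s C d` is the parity with
which the cycle `C` winds around this side. If the winding parities on the two sides of an edge
differ exactly for the cycles through the edge, and if each side is continued around its face by the
side of a next dart, then there are few edges: each face has at least three sides. -/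
theorem card_edgeSet_add_six_le [Nonempty G.Dart]
    (s : (G.edgeSet → ZMod 2) →ₗ[ZMod 2] (G.Dart → ZMod 2))
    (hside : ∀ C ∈ LinearMap.ker (boundary G), ∀ d : G.Dart,
      s C d + s C d.symm = C ⟨d.edge, d.edge_mem⟩)
    (hnext : ∀ d : G.Dart, ∃ d' : G.Dart, d'.fst = d.snd ∧ d'.snd ≠ d.fst ∧
      ∀ C ∈ LinearMap.ker (boundary G), s C d = s C d') :
    Fintype.card G.edgeSet + 6 ≤ 3 * Fintype.card V := by
  classical
  let Z := LinearMap.ker (boundary G)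
  have : Nonempty V := ⟨(Classical.arbitrary G.Dart).fst⟩
  let R : Setoid G.Dart :=
    ⟨fun d d' => ∀ C ∈ Z, s C d = s C d', fun _ _ _ => rfl, fun h C hC => (h C hC).symm,
      fun h h' C hC => (h C hC).trans (h' C hC)⟩
  let Q := Quotient R
  let L : (Z × ZMod 2) →ₗ[ZMod 2] (Q → ZMod 2) :=
    { toFun := fun x => Quotient.lift (fun d => s x.1.1 d + x.2)
        fun d d' h => by rw [h x.1.1 x.1.2]
      map_add' := by
        intro x y; ext q
        induction q using Quotient.inductionOn
        simp; ring
      map_smul' := by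
        intro k x; ext q
        induction q using Quotient.inductionOn
        simp; ring }
  have hL : ∀ x : Z × ZMod 2, ∀ d, L x (Quotient.mk R d) = s x.1.1 d + x.2 := fun _ _ => rfl
  have hinj : Function.Injective L := by
    rw [← LinearMap.ker_eq_bot, LinearMap.ker_eq_bot']
    rintro ⟨C, k⟩ h0
    have h0' : ∀ d, s C.1 d + k = 0 := fun d => by
      have := congrFun h0 (Quotient.mk R d)
      rwa [hL] at this
    have hC : C = 0 := by
      ext e
      obtain ⟨e, he⟩ := e
      induction e with
      | h a b =>
        have h1 := hside C.1 C.2 ⟨(a, b), he⟩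
        have h2 := h0' ⟨(a, b), he⟩
        have h3 := h0' (SimpleGraph.Dart.symm ⟨(a, b), he⟩)
        have h4 : C.1 ⟨s(a, b), he⟩ = 0 := by
          rw [show C.1 ⟨s(a, b), he⟩ = _ from h1.symm]
          linear_combination h2 + h3 - CharTwo.add_self_eq_zero k
        exact h4
    have hk := h0' (Classical.arbitrary _)
    rw [hC] at hk
    simp only [ZeroMemClass.coe_zero, map_zero, Pi.zero_apply, zero_add] at hk
    rw [hC, hk]; rfl
  have hrank := LinearMap.finrank_le_finrank_of_injective hinj
  rw [Module.finrank_prod, Module.finrank_self, Module.finrank_fintype_fun_eq_card] at hrank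
  have h3 : 3 * Fintype.card Q ≤ Fintype.card G.Dart := by
    have hf := Finset.card_eq_sum_card_fiberwise (f := Quotient.mk R) (s := Finset.univ)
      (t := Finset.univ) (fun _ _ => by simp)
    rw [← Finset.card_univ (α := G.Dart), hf, mul_comm, ← smul_eq_mul, ← Finset.card_univ]
    refine Finset.card_nsmul_le_sum _ _ _ fun q _ => ?_
    obtain ⟨d, rfl⟩ := Quotient.exists_rep q
    obtain ⟨d', h1, h2, h3⟩ := hnext d
    obtain ⟨d'', h4, h5, h6⟩ := hnext d'
    have n1 : d ≠ d' := fun h => d.adj.ne (by rw [← h1, ← h])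
    have n2 : d' ≠ d'' := fun h => d'.adj.ne (by rw [← h4, ← h])
    have n3 : d ≠ d'' := fun h => h2 (by rw [← h4, ← h])
    have hsub : ({d, d', d''} : Finset G.Dart) ⊆
        Finset.univ.filter fun x => Quotient.mk R x = Quotient.mk R d := by
      intro x hx
      simp only [Finset.mem_insert, Finset.mem_singleton] at hx
      simp only [Finset.mem_filter, Finset.mem_univ, true_and]
      rcases hx with rfl | rfl | rfl
      · rfl
      · exact (Quotient.sound h3).symm
      · exact (Quotient.sound fun C hC => (h3 C hC).trans (h6 C hC)).symm
    have := Finset.card_le_card hsub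
    rwa [Finset.card_eq_three.2 ⟨d, d', d'', n1, n3, n2, rfl⟩] at this
  have hd : Fintype.card G.Dart = 2 * Fintype.card G.edgeSet := by
    rw [G.dart_card_eq_twice_card_edges, SimpleGraph.edgeFinset, Set.toFinset_card]
    congr!
  have hE := card_edgeSet_le_finrank_ker (G := G)
  change Module.finrank (ZMod 2) Z + 1 ≤ Fintype.card Q at hrank
  change Fintype.card G.edgeSet + 1 ≤ Module.finrank (ZMod 2) Z + Fintype.card V at hE
  omega

/-- Every plane graph with an edge in which no edge ends in a vertex of degree one has at most
`3 * |V| - 6` edges. -/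
theorem _root_.PlaneDrawing.card_edgeSet_add_six_le [Nonempty G.Dart] (P : PlaneDrawing G)
    (hdeg : ∀ d : G.Dart, ∃ w, w ≠ d.fst ∧ G.Adj d.snd w) :
    Fintype.card G.edgeSet + 6 ≤ 3 * Fintype.card V := by
  classical
  let x : V → Plane := P.point
  let A : G.Dart → Set Plane := fun d => P.curve d.edge
  have hAs : ∀ d : G.Dart, A d.symm = A d := fun d => by simp [A]
  let D : Set Plane := ⋃ d : G.Dart, A d
  have harc : ∀ d : G.Dart, IsPolygonalArc (x d.fst) (x d.snd) (A d) := fun d =>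
    P.isPolygonalArc _ _ d.adj
  have hclosed : ∀ d, IsClosed (A d) := fun d => (harc d).isClosed
  have hmeet : ∀ d d' : G.Dart, d.edge ≠ d'.edge → ∀ p, p ∈ A d → p ∈ A d' →
      ∃ w, w ∈ d.edge ∧ w ∈ d'.edge ∧ p = x w := fun d d' h p h1 h2 =>
    P.eq_point_of_mem _ d.edge_mem _ d'.edge_mem h p h1 h2
  have hmem : ∀ (d : G.Dart) v, v ∈ d.edge ↔ v = d.fst ∨ v = d.snd := fun d v => by
    rw [show d.edge = s(d.fst, d.snd) from rfl, Sym2.mem_iff]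
  have hunb : ∀ d : G.Dart, IsUnbranched D (A d) (x d.fst) (x d.snd) := by
    intro d p hp h1 h2
    have : ∀ d' : G.Dart, ∀ᶠ p' in 𝓝 p, p' ∈ A d' → p' ∈ A d := by
      intro d'
      by_cases h : d.edge = d'.edge
      · exact Eventually.of_forall fun p' hp' => by simpa only [A, h] using hp'
      · have hn : p ∉ A d' := fun h' => by
          obtain ⟨w, hw, -, rfl⟩ := hmeet d d' h p hp h'
          rcases (hmem d w).1 hw with rfl | rfl
          · exact h1 rfl
          · exact h2 rfl
        filter_upwards [eventually_not_mem (hclosed d') hn] with p' h3 h4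
        exact absurd h4 h3
    filter_upwards [eventually_all.2 this] with p' hp' hD
    obtain ⟨d', hd'⟩ := Set.mem_iUnion.1 hD
    exact hp' d' hd'
  choose z z' hz hz' hface S hSf hpar using fun d => (harc d).exists_ends
  obtain ⟨c, hc⟩ := (Set.finite_iUnion hSf).exists_notMem
  have hc : ∀ d, c ∉ S d := fun d h => hc (Set.mem_iUnion.2 ⟨d, h⟩)
  have hpar' := fun d => hpar d c (hc d)
  choose hshear χ hχ hjump using hpar'
  have hmid : ∀ a b : Plane, ∃ m, m ∈ openSegment ℝ a b := fun a b =>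
    ⟨_, mem_openSegment_iff_smul.2 ⟨1 / 2, by norm_num, by norm_num, rfl⟩⟩
  choose q hq using fun d : G.Dart => hmid (x d.fst) (z d)
  have hne : ∀ d, x d.fst - z d ≠ 0 := fun d => sub_ne_zero.2 (hz d).ne.symm
  -- a point in the face to the right of the dart
  have hr : ∀ d, ∃ p, LeftOf D (q d) (x d.fst - z d) p := fun d => by
    refine exists_leftOf (hne d) (((hz d).near_of_isUnbranched (hunb d) _ (hq d)).mono
      fun p hp hpD => ?_)
    have := cross_eq_zero_of_mem_segment (-1) (hp hpD)
      (openSegment_subset_segment _ _ _ (hq d))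
    rwa [neg_one_smul, neg_sub] at this
  choose r hr using hr
  have hsymm : ∀ d : G.Dart, IsEndSegment (A d) (x d.snd) (x d.fst) (z d.symm) := fun d => by
    have := hz d.symm
    rw [hAs] at this
    exact this
  have hqs : ∀ d : G.Dart, q d.symm ∈ openSegment ℝ (x d.snd) (z d.symm) := fun d => hq d.symm
  -- following an arc from one end to the other
  have hR : ∀ d : G.Dart, SameFace D (q d) (x d.fst - z d) (q d.symm) (z d.symm - x d.snd) := by
    intro d
    obtain ⟨m, hm⟩ := hmid (x d.snd) (z' d)
    have h1 := (hface d D (hunb d) (q d) (hq d) m hm).2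
    have h2 := (hz' d).sameFace (hsymm d) (hunb d).symm one_ne_zero hm (hqs d)
    rw [one_smul, one_smul] at h2
    exact h1.trans (sub_ne_zero.2 (hz' d).ne) h2
  have hLl : ∀ d : G.Dart, SameFace D (q d) (z d - x d.fst) (q d.symm) (x d.snd - z d.symm) := by
    intro d
    obtain ⟨m, hm⟩ := hmid (x d.snd) (z' d)
    have h1 := (hface d D (hunb d) (q d) (hq d) m hm).1
    have h2 := (hz' d).sameFace (hsymm d) (hunb d).symm (neg_ne_zero.2 one_ne_zero) hm (hqs d)
    rw [neg_one_smul, neg_one_smul, neg_sub, neg_sub] at h2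
    exact h1.trans (sub_ne_zero.2 (hz' d).ne.symm) h2
  -- turning at the head of a dart
  have hnext : ∀ d : G.Dart, ∃ d' : G.Dart, d'.fst = d.snd ∧ d'.snd ≠ d.fst ∧
      JoinedIn Dᶜ (r d) (r d') := by
    intro d
    let ι := {w // G.Adj d.snd w}
    let δ : ι → G.Dart := fun w => ⟨(d.snd, w.1), w.2⟩
    have hδe : ∀ i j : ι, i ≠ j → (δ i).edge ≠ (δ j).edge := by
      intro i j hij h
      refine hij (Subtype.ext ?_)
      have h' : s(d.snd, i.1) = s(d.snd, j.1) := h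
      exact Sym2.congr_right.1 h'
    obtain ⟨w, hw, hadj⟩ := hdeg d
    obtain ⟨j, hj, H⟩ := exists_sameFace_of_segments (D := D) (c := x d.snd)
      (z := fun w : ι => z (δ w)) (fun w => (hz (δ w)).ne)
      (by
        rintro i j hij p ⟨h1, h2⟩
        obtain ⟨v, hv1, hv2, rfl⟩ := hmeet (δ i) (δ j) (hδe i j hij) p ((hz (δ i)).subset h1)
          ((hz (δ j)).subset h2)
        rcases (hmem (δ i) v).1 hv1 with hv1 | hv1
        · simp [hv1, δ]
        rcases (hmem (δ j) v).1 hv2 with hv2 | hv2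
        · simp [hv2, δ]
        exact absurd (Subtype.ext (hv1.symm.trans hv2)) hij)
      (by
        have : ∀ d' : G.Dart, ∀ᶠ p in 𝓝 (x d.snd), p ∈ A d' →
            ∃ i : ι, p ∈ segment ℝ (x d.snd) (z (δ i)) := by
          intro d'
          by_cases h : x d.snd ∈ A d'
          · have hv := P.mem_of_point_mem _ d'.edge_mem _ h
            obtain ⟨i, hi⟩ : ∃ i : ι, A (δ i) = A d' := by
              rcases (hmem d' _).1 hv with hv | hv
              · refine ⟨⟨d'.snd, hv ▸ d'.adj⟩, ?_⟩
                have : δ ⟨d'.snd, hv ▸ d'.adj⟩ = d' := by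
                  ext <;> simp [δ, hv]
                rw [this]
              · refine ⟨⟨d'.fst, hv ▸ d'.adj.symm⟩, ?_⟩
                have : δ ⟨d'.fst, hv ▸ d'.adj.symm⟩ = d'.symm := by
                  ext <;> simp [δ, hv]
                rw [this, hAs]
            filter_upwards [(hz (δ i)).near_end] with p hp hpA
            exact ⟨i, hp (hi ▸ hpA)⟩
          · filter_upwards [eventually_not_mem (hclosed d') h] with p h1 h2
            exact absurd h2 h1
        filter_upwards [eventually_all.2 this] with p hp hpD
        obtain ⟨d', hd'⟩ := Set.mem_iUnion.1 hpD
        exact hp d' hd')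
      (fun i => (hz (δ i)).near_of_isUnbranched (hunb (δ i)))
      ⟨d.fst, d.adj.symm⟩ ⟨⟨w, hadj⟩, fun h => hw (congrArg Subtype.val h)⟩
    refine ⟨δ j, rfl, fun h => hj (Subtype.ext h), ?_⟩
    have h1 := H _ (hqs d) _ (hq (δ j))
    obtain ⟨p, hp1, hp2⟩ := (hR d).trans (sub_ne_zero.2 (hsymm d).ne) h1
    exact ((hr d).joinedIn (hne d) hp1).trans (hp2.joinedIn (hne (δ j)) (hr (δ j)))
  have ho : ∀ e : G.edgeSet, ∃ d : G.Dart, d.edge = e := by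
    rintro ⟨e, he⟩
    induction e with
    | h a b => exact ⟨⟨(a, b), he⟩, rfl⟩
  choose o ho using ho
  let W : (G.edgeSet → ZMod 2) → Plane → ZMod 2 := fun C p => ∑ e, C e * χ (o e) p
  have hW : ∀ C ∈ LinearMap.ker (boundary G), ∀ p₀ ∈ Dᶜ, ∀ᶠ p in 𝓝 p₀, W C p = W C p₀ := by
    intro C hC p₀ hp₀
    have hall : ∀ᶠ p in 𝓝 p₀, ∀ e, χ (o e) p = χ (o e) p₀ +
        endCorrection c p₀ p (x (o e).fst) + endCorrection c p₀ p (x (o e).snd) :=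
      eventually_all.2 fun e => hχ (o e) p₀ fun h => hp₀ (Set.mem_iUnion.2 ⟨_, h⟩)
    filter_upwards [hall] with p hp
    have h1 := sum_mul_boundary C (fun v => endCorrection c p₀ p (x v)) o ho
    rw [LinearMap.mem_ker.1 hC] at h1
    simp only [Pi.zero_apply, mul_zero, Finset.sum_const_zero] at h1
    calc W C p = W C p₀ + ∑ e, C e * (endCorrection c p₀ p (x (o e).fst) +
          endCorrection c p₀ p (x (o e).snd)) := by
            simp only [W, ← Finset.sum_add_distrib]
            exact Finset.sum_congr rfl fun e _ => by rw [hp e]; ring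
      _ = W C p₀ := by rw [← h1, add_zero]
  have hWj : ∀ C ∈ LinearMap.ker (boundary G), ∀ p p', JoinedIn Dᶜ p p' → W C p = W C p' := by
    intro C hC p p' h
    have hlc : IsLocallyConstant fun t => W C (h.somePath t) := by
      rw [IsLocallyConstant.iff_eventually_eq]
      intro t
      exact h.somePath.continuous.continuousAt.eventually (hW C hC _ (h.somePath_mem t))
    simpa using hlc.apply_eq_of_preconnectedSpace 0 1
  have hedge : ∀ d d' : G.Dart, d'.edge ≠ d.edge → ∀ᶠ s : ℝ in 𝓝[>] 0,
      χ d' (q d + s • rayDir c) + χ d' (q d - s • rayDir c) = 0 := by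
    intro d d' hdd'
    have hqd : q d ∉ A d' := fun h => by
      obtain ⟨w, hw, -, hqw⟩ := hmeet d d' hdd'.symm _
        ((hz d).subset (openSegment_subset_segment _ _ _ (hq d))) h
      rcases (hmem d w).1 hw with rfl | rfl
      · exact left_notMem_openSegment (hz d).ne (hqw ▸ hq d)
      · exact (hz d).not_mem (hqw ▸ hq d)
    have hnear := hχ d' _ hqd
    have t1 : Tendsto (fun s : ℝ => q d + s • rayDir c) (𝓝[>] 0) (𝓝 (q d)) := by
      have : Continuous (fun s : ℝ => q d + s • rayDir c) := by fun_prop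
      simpa using (this.tendsto 0).mono_left nhdsWithin_le_nhds
    have t2 : Tendsto (fun s : ℝ => q d - s • rayDir c) (𝓝[>] 0) (𝓝 (q d)) := by
      have : Continuous (fun s : ℝ => q d - s • rayDir c) := by fun_prop
      simpa using (this.tendsto 0).mono_left nhdsWithin_le_nhds
    filter_upwards [t1.eventually hnear, t2.eventually hnear] with s h1 h2
    have hsh : shear c (q d - s • rayDir c) = shear c (q d) := by
      rw [sub_eq_add_neg, ← neg_smul, shear_add_smul_rayDir]
    rw [h1, h2]
    simp only [endCorrection_eq_zero (shear_add_smul_rayDir c s (q d)), endCorrection_eq_zero hsh]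
    linear_combination CharTwo.add_self_eq_zero (χ d' (q d))
  -- the two sides of an edge
  have hside : ∀ C ∈ LinearMap.ker (boundary G), ∀ e : G.edgeSet,
      W C (r (o e)) + W C (r (o e).symm) = C e := by
    intro C hC e
    set d := o e with hd
    have hl : LeftOf D (q d) (z d - x d.fst) (r d.symm) := by
      obtain ⟨p, h1, h2⟩ := hLl d
      exact h1.of_joinedIn (h2.joinedIn (sub_ne_zero.2 (hsymm d).ne.symm) (hr d.symm))
    have t1 : Tendsto (fun s : ℝ => q d + s • rayDir c) (𝓝[>] 0) (𝓝 (q d)) := by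
      have : Continuous (fun s : ℝ => q d + s • rayDir c) := by fun_prop
      simpa using (this.tendsto 0).mono_left nhdsWithin_le_nhds
    have t2 : Tendsto (fun s : ℝ => q d - s • rayDir c) (𝓝[>] 0) (𝓝 (q d)) := by
      have : Continuous (fun s : ℝ => q d - s • rayDir c) := by fun_prop
      simpa using (this.tendsto 0).mono_left nhdsWithin_le_nhds
    have hall : ∀ᶠ s : ℝ in 𝓝[>] 0, ∀ e', e' ≠ e →
        χ (o e') (q d + s • rayDir c) + χ (o e') (q d - s • rayDir c) = 0 :=
      eventually_all.2 fun e' => eventually_imp_distrib_left.2 fun he' =>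
        hedge d (o e') fun h => he' (Subtype.ext (by rw [← ho e', ← ho e, h]))
    obtain ⟨s, hs1, hs2, hs3, hs4, hs5, hs6, hs7⟩ :=
      ((t1.eventually (hr d)).and ((t2.eventually (hr d)).and ((t1.eventually hl).and
        ((t2.eventually hl).and (hall.and ((hjump d _ (hq d)).and self_mem_nhdsWithin)))))).exists
    have hs7 : (0 : ℝ) < s := hs7
    have hsum : W C (q d + s • rayDir c) + W C (q d - s • rayDir c) = C e := by
      simp only [W, ← Finset.sum_add_distrib, ← mul_add]
      rw [Finset.sum_eq_single e (fun e' _ he' => by rw [hs5 e' he', mul_zero]) (by simp),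
        hs6, mul_one]
    rw [← hsum]
    have hcr1 : ∀ y : Plane, cross y (q d + s • rayDir c - q d) = s * shear c y := by
      intro y; simp [cross, shear]; ring
    have hcr2 : ∀ y : Plane, cross y (q d - s • rayDir c - q d) = -(s * shear c y) := by
      intro y; simp [cross, shear]; ring
    rcases lt_or_gt_of_ne (hshear d) with h | h
    · have h1 := hWj C hC _ _ (hs3 (by
        rw [hcr1, shear_sub]; exact mul_pos hs7 (by linarith)))
      have h2 := hWj C hC _ _ (hs2 (by
        rw [hcr2, shear_sub]; nlinarith [mul_pos hs7 (sub_pos.2 h)]))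
      rw [h1, h2, add_comm]
    · have h1 := hWj C hC _ _ (hs1 (by
        rw [hcr1, shear_sub]; exact mul_pos hs7 (by linarith)))
      have h2 := hWj C hC _ _ (hs4 (by
        rw [hcr2, shear_sub]; nlinarith [mul_pos hs7 (sub_pos.2 h)]))
      rw [h1, h2]
  refine PlaneGraph.card_edgeSet_add_six_le
    { toFun := fun C d => W C (r d)
      map_add' := fun C C' => by
        ext d; simp [W, add_mul, Finset.sum_add_distrib]
      map_smul' := fun k C => by
        ext d; simp [W, Finset.mul_sum, mul_assoc] } ?_ ?_
  · intro C hC d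
    have h := hside C hC ⟨d.edge, d.edge_mem⟩
    rcases (SimpleGraph.dart_edge_eq_iff _ _).1 (ho ⟨d.edge, d.edge_mem⟩) with h' | h'
    · rw [h'] at h; exact h
    · rw [h', SimpleGraph.Dart.symm_symm, add_comm] at h; exact h
  · intro d
    obtain ⟨d', h1, h2, h3⟩ := hnext d
    exact ⟨d', h1, h2, fun C hC => hWj C hC _ _ h3⟩

end EdgeBound

/-! ### Straight-line drawings -/

/-- The map `x` draws the graph `H` in the plane with straight edges and without crossings. -/
structure IsStraightDrawing {U : Type*} (H : SimpleGraph U) (x : U → Plane) : Prop where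
  injective : Function.Injective x
  eq_of_mem : ∀ a b, H.Adj a b → ∀ w, x w ∈ segment ℝ (x a) (x b) → w = a ∨ w = b
  eq_of_mem_mem : ∀ a b u v, H.Adj a b → H.Adj u v → s(a, b) ≠ s(u, v) →
    ∀ p ∈ segment ℝ (x a) (x b), p ∈ segment ℝ (x u) (x v) →
      ∃ w, (w = a ∨ w = b) ∧ (w = u ∨ w = v) ∧ p = x w

/-- A straight-line drawing of a graph contains a drawing of each of its subgraphs. -/
def IsStraightDrawing.planeDrawing {U : Type*} {G H : SimpleGraph U} {x : U → Plane}
    (h : IsStraightDrawing H x) (hGH : G ≤ H) : PlaneDrawing G where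
  point := x
  curve := Sym2.lift ⟨fun a b => segment ℝ (x a) (x b), fun _ _ => segment_symm _ _ _⟩
  point_injective := h.injective
  isPolygonalArc u v huv := .single fun e => huv.ne (h.injective e)
  mem_of_point_mem e he w hw := by
    induction e with
    | h a b => exact Sym2.mem_iff.2 (h.eq_of_mem a b (hGH he) w hw)
  eq_point_of_mem e he f hf hef p hp hp' := by
    induction e with
    | h a b =>
      induction f with
      | h u v =>
        obtain ⟨w, h1, h2, h3⟩ := h.eq_of_mem_mem a b u v (hGH he) (hGH hf) hef p hp hp'
        exact ⟨w, Sym2.mem_iff.2 h1, Sym2.mem_iff.2 h2, h3⟩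

/-- The graph `H` with a new vertex adjacent to `u` and `v`. -/
def apexGraph {U : Type*} (H : SimpleGraph U) (u v : U) : SimpleGraph (Option U) :=
  SimpleGraph.fromRel fun a b =>
    (∃ a' b', a = some a' ∧ b = some b' ∧ H.Adj a' b') ∨ (a = none ∧ (b = some u ∨ b = some v))

lemma apexGraph_adj_some {U : Type*} {H : SimpleGraph U} {u v a b : U} :
    (apexGraph H u v).Adj (some a) (some b) ↔ H.Adj a b := by
  simpa [apexGraph, H.adj_comm b a] using fun h : H.Adj a b => h.ne

lemma apexGraph_adj_none {U : Type*} {H : SimpleGraph U} {u v a : U} :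
    (apexGraph H u v).Adj none (some a) ↔ a = u ∨ a = v := by
  simp [apexGraph]

lemma segment_inter_subset {a b c : Plane} (h : cross (a - c) (b - c) ≠ 0) :
    segment ℝ c a ∩ segment ℝ c b ⊆ {c} := by
  rintro p ⟨h1, h2⟩
  obtain ⟨t, -, -, rfl⟩ := mem_segment_iff_smul.1 h1
  obtain ⟨s, -, -, hs⟩ := mem_segment_iff_smul.1 h2
  have hts : t • (a - c) = s • (b - c) := by simpa using hs
  have : t * cross (a - c) (b - c) = 0 := by
    rw [← cross_smul_left, hts, ← one_smul ℝ (b - c), smul_smul, cross_self_smul]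
  rcases mul_eq_zero.1 this with h0 | h0
  · simp [h0]
  · exact absurd h0 h

lemma eventually_disjoint_segment {K : Set Plane} (hK : IsClosed K) {A m n : Plane}
    (h : ∀ p ∈ segment ℝ A m, p ∉ K) :
    ∀ᶠ ε : ℝ in 𝓝[>] 0, ∀ p ∈ segment ℝ A (m + ε • n), p ∉ K := by
  have key : ∀ᶠ ε : ℝ in 𝓝 0, ∀ t ∈ Set.Icc (0 : ℝ) 1, A + t • (m + ε • n - A) ∉ K := by
    refine isCompact_Icc.eventually_forall_of_forall_eventually fun t ht => ?_
    have hc : Continuous fun z : ℝ × ℝ => A + z.2 • (m + z.1 • n - A) := by fun_prop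
    refine hc.continuousAt.eventually (eventually_not_mem hK (h _ ?_))
    exact mem_segment_iff_smul.2 ⟨t, ht.1, ht.2, by simp⟩
  filter_upwards [nhdsWithin_le_nhds key] with ε hε p hp
  obtain ⟨t, h0, h1, rfl⟩ := mem_segment_iff_smul.1 hp
  exact hε t ⟨h0, h1⟩

/-- A segment from `A` that is turned slightly away from the direction `d` meets a given segment
from `A` only in `A`. -/
lemma eventually_segment_inter_subset {A d n y : Plane} (hdn : cross d n ≠ 0) (hy : y ≠ A) :
    ∀ᶠ ε : ℝ in 𝓝[>] 0, ∀ p ∈ segment ℝ A (A + (1 / 2 : ℝ) • d + ε • n),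
      p ∈ segment ℝ A y → p = A := by
  have hcr : ∀ ε : ℝ, cross (A + (1 / 2 : ℝ) • d + ε • n - A) (y - A) =
      1 / 2 * cross d (y - A) + ε * cross n (y - A) := by
    intro ε; simp [cross]; ring
  have hne : ∀ᶠ ε : ℝ in 𝓝[>] 0, 1 / 2 * cross d (y - A) + ε * cross n (y - A) ≠ 0 := by
    by_cases h0 : cross d (y - A) = 0
    · have h1 : cross n (y - A) ≠ 0 := by
        intro h1
        refine hy (plane_ext ?_ ?_)
        · have : cross d n * (y 0 - A 0) = 0 := by
            simp only [cross, PiLp.sub_apply] at h0 h1 ⊢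
            linear_combination n 0 * h0 - d 0 * h1
          linarith [(mul_eq_zero.1 this).resolve_left hdn]
        · have : cross d n * (y 1 - A 1) = 0 := by
            simp only [cross, PiLp.sub_apply] at h0 h1 ⊢
            linear_combination n 1 * h0 - d 1 * h1
          linarith [(mul_eq_zero.1 this).resolve_left hdn]
      filter_upwards [self_mem_nhdsWithin] with ε hε
      have hε : (0 : ℝ) < ε := hε
      rw [h0, mul_zero, zero_add]
      exact mul_ne_zero hε.ne' h1
    · have hc : Continuous fun ε : ℝ => 1 / 2 * cross d (y - A) + ε * cross n (y - A) := by
        fun_prop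
      exact nhdsWithin_le_nhds (hc.continuousAt.eventually_ne (by simpa using h0))
  filter_upwards [hne] with ε hε p h1 h2
  exact segment_inter_subset (by rw [hcr]; exact hε) ⟨h1, h2⟩

/-- When a point approaches the middle of the edge `uv` along a line that crosses the edge, the
segment from `u` to the point finally meets the drawing only in `u`. -/
lemma IsStraightDrawing.eventually_side {U : Type*} [Finite U] {H : SimpleGraph U} {x : U → Plane}
    (h : IsStraightDrawing H x) {u v : U} (huv : H.Adj u v) {n : Plane}
    (hn : cross (x v - x u) n ≠ 0) :
    ∀ᶠ ε : ℝ in 𝓝[>] 0,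
      (∀ a b, H.Adj a b → ∀ p ∈ segment ℝ (x u) (x u + (1 / 2 : ℝ) • (x v - x u) + ε • n),
        p ∈ segment ℝ (x a) (x b) → p = x u ∧ (u = a ∨ u = b)) ∧
      ∀ w, w ≠ u → x w ∉ segment ℝ (x u) (x u + (1 / 2 : ℝ) • (x v - x u) + ε • n) := by
  have hvu : x v ≠ x u := fun e => huv.ne (h.injective e).symm
  set m := x u + (1 / 2 : ℝ) • (x v - x u) with hm
  have hsub : segment ℝ (x u) m ⊆ segment ℝ (x u) (x v) :=
    (convex_segment _ _).segment_subset (left_mem_segment _ _ _)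
      (mem_segment_iff_smul.2 ⟨1 / 2, by norm_num, by norm_num, rfl⟩)
  have hvm : x v ∉ segment ℝ (x u) m := by
    intro hv
    obtain ⟨t, h0, h1, ht⟩ := mem_segment_iff_smul.1 hv
    have : (1 - t / 2) • (x v - x u) = 0 := by
      have : x v - x u = (t / 2) • (x v - x u) := by
        nth_rewrite 1 [ht]; rw [hm]; module
      rw [sub_smul, one_smul, ← this, sub_self]
    rcases smul_eq_zero.1 this with h' | h'
    · linarith
    · exact hvu (sub_eq_zero.1 h')
  refine Eventually.and ?_ ?_
  · refine eventually_all.2 fun a => eventually_all.2 fun b =>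
      eventually_imp_distrib_left.2 fun hab => ?_
    have hxab : x a ≠ x b := fun e => hab.ne (h.injective e)
    by_cases hau : a = u
    · subst hau
      filter_upwards [eventually_segment_inter_subset hn hxab.symm] with ε hε p h1 h2
      exact ⟨hε p h1 h2, Or.inl rfl⟩
    by_cases hbu : b = u
    · subst hbu
      filter_upwards [eventually_segment_inter_subset hn hxab] with ε hε p h1 h2
      exact ⟨hε p h1 (segment_symm ℝ (x a) (x b) ▸ h2), Or.inr rfl⟩
    have hdis : ∀ p ∈ segment ℝ (x u) m, p ∉ segment ℝ (x a) (x b) := by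
      intro p hp hp'
      have hs : s(a, b) ≠ s(u, v) := by
        intro e
        have : u ∈ s(a, b) := e ▸ Sym2.mem_mk_left u v
        rcases Sym2.mem_iff.1 this with e | e
        · exact hau e.symm
        · exact hbu e.symm
      obtain ⟨w, h1, h2, rfl⟩ := h.eq_of_mem_mem a b u v hab huv hs p hp' (hsub hp)
      rcases h2 with rfl | rfl
      · rcases h1 with h1 | h1
        · exact hau h1.symm
        · exact hbu h1.symm
      · exact hvm hp
    filter_upwards [eventually_disjoint_segment (n := n) (isClosed_segment _ _) hdis]
      with ε hε p h1 h2
    exact absurd h2 (hε p h1)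
  · refine eventually_all.2 fun w => eventually_imp_distrib_left.2 fun hw => ?_
    have hdis : ∀ p ∈ segment ℝ (x u) m, p ∉ ({x w} : Set Plane) := by
      rintro p hp rfl
      rcases h.eq_of_mem u v huv w (hsub hp) with rfl | rfl
      · exact hw rfl
      · exact hvm hp
    filter_upwards [eventually_disjoint_segment (n := n) isClosed_singleton hdis] with ε hε h1
    exact hε _ h1 rfl

/-- A new vertex close to the middle of an edge can be joined to both ends of the edge. -/
theorem IsStraightDrawing.exists_apexGraph {U : Type*} [Finite U] {H : SimpleGraph U}
    {x : U → Plane} (h : IsStraightDrawing H x) {u v : U} (huv : H.Adj u v) :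
    ∃ y, IsStraightDrawing (apexGraph H u v) y := by
  have hvu : x v - x u ≠ 0 := fun e => huv.ne (h.injective (sub_eq_zero.1 e)).symm
  set n := quarterTurn (x v - x u) with hndef
  have hdn : cross (x v - x u) n = (x v - x u) 0 ^ 2 + (x v - x u) 1 ^ 2 := by
    simp only [cross, hndef, quarterTurn_zero, quarterTurn_one]; ring
  have hn : 0 < cross (x v - x u) n := by rw [hdn]; exact sq_add_sq_pos hvu
  have hn' : cross (x u - x v) n ≠ 0 := by
    have : cross (x u - x v) n = -cross (x v - x u) n := by
      simp only [cross, PiLp.sub_apply]; ring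
    rw [this]; exact neg_ne_zero.2 hn.ne'
  obtain ⟨ε, ⟨hu1, hu2⟩, ⟨hv1, hv2⟩, hε⟩ := ((h.eventually_side huv hn.ne').and
    ((h.eventually_side huv.symm hn').and self_mem_nhdsWithin)).exists
  have hε : (0 : ℝ) < ε := hε
  have hmid : x v + (1 / 2 : ℝ) • (x u - x v) = x u + (1 / 2 : ℝ) • (x v - x u) := by module
  rw [hmid] at hv1 hv2
  set p := x u + (1 / 2 : ℝ) • (x v - x u) + ε • n with hp
  have hcr : cross (x u - p) (x v - p) = ε * cross (x v - x u) n := by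
    simp only [cross, hp, PiLp.sub_apply, PiLp.add_apply, PiLp.smul_apply, smul_eq_mul]; ring
  have hcr0 : cross (x u - p) (x v - p) ≠ 0 := by rw [hcr]; exact (mul_pos hε hn).ne'
  have hpu : p ≠ x u := fun e => hcr0 (by simp [cross, ← e])
  have hpv : p ≠ x v := fun e => hcr0 (by simp [cross, ← e])
  have hpx : ∀ w, p ≠ x w := by
    intro w e
    by_cases hw : w = u
    · exact hpu (hw ▸ e)
    · exact hu2 w hw (e ▸ right_mem_segment _ _ _)
  have hpe : ∀ a b, H.Adj a b → p ∉ segment ℝ (x a) (x b) := fun a b hab hpab =>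
    hpu (hu1 a b hab p (right_mem_segment _ _ _) hpab).1
  -- both new edges, from an end `a` of the given edge
  have hnew1 : ∀ a, a = u ∨ a = v → ∀ b c, H.Adj b c → ∀ z ∈ segment ℝ (x a) p,
      z ∈ segment ℝ (x b) (x c) → z = x a ∧ (a = b ∨ a = c) := by
    rintro a (rfl | rfl)
    · exact hu1
    · exact hv1
  have hnew2 : ∀ a, a = u ∨ a = v → ∀ w, w ≠ a → x w ∉ segment ℝ (x a) p := by
    rintro a (rfl | rfl)
    · exact hu2
    · exact hv2
  have hnew3 : ∀ a b, (a = u ∨ a = v) → (b = u ∨ b = v) → a ≠ b →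
      ∀ z ∈ segment ℝ (x a) p, z ∈ segment ℝ (x b) p → z = p := by
    have hs := segment_inter_subset hcr0
    rintro a b (rfl | rfl) (rfl | rfl) hab z h1 h2
    · exact absurd rfl hab
    · rw [segment_symm] at h1 h2; exact hs ⟨h1, h2⟩
    · rw [segment_symm] at h1 h2; exact hs ⟨h2, h1⟩
    · exact absurd rfl hab
  let y : Option U → Plane := fun o => o.elim p x
  -- every edge is an old one or joins the new vertex to an end of the given edge
  have hadj : ∀ a b, (apexGraph H u v).Adj a b →
      (∃ a' b', H.Adj a' b' ∧ s(a, b) = s(some a', some b') ∧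
        segment ℝ (y a) (y b) = segment ℝ (x a') (x b')) ∨
      ∃ a', (a' = u ∨ a' = v) ∧ s(a, b) = s(some a', none) ∧
        segment ℝ (y a) (y b) = segment ℝ (x a') p := by
    intro a b hab
    rcases a with _ | a <;> rcases b with _ | b
    · exact absurd rfl hab.ne
    · exact Or.inr ⟨b, apexGraph_adj_none.1 hab, Sym2.eq_swap, segment_symm _ _ _⟩
    · exact Or.inr ⟨a, apexGraph_adj_none.1 hab.symm, rfl, rfl⟩
    · exact Or.inl ⟨a, b, apexGraph_adj_some.1 hab, rfl, rfl⟩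
  refine ⟨y, ?_, ?_, ?_⟩
  · rintro (_ | a) (_ | b) hab
    · rfl
    · exact absurd hab (hpx b)
    · exact absurd hab.symm (hpx a)
    · exact congrArg some (h.injective hab)
  · intro a b hab w hw
    rw [← Sym2.mem_iff]
    rcases hadj a b hab with ⟨a', b', h1, h2, h3⟩ | ⟨a', h1, h2, h3⟩
    · rw [h3] at hw
      rw [h2, Sym2.mem_iff]
      rcases w with _ | w
      · exact absurd hw (hpe _ _ h1)
      · simpa using h.eq_of_mem _ _ h1 w hw
    · rw [h3] at hw
      rw [h2, Sym2.mem_iff]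
      rcases w with _ | w
      · simp
      · by_contra hne
        exact hnew2 a' h1 w (by simpa using hne) hw
  · intro a b c d hab hcd hne z hz hz'
    simp only [← Sym2.mem_iff (a := _) (b := _)]
    rcases hadj a b hab with ⟨a', b', h1, h2, h3⟩ | ⟨a', h1, h2, h3⟩ <;>
    rcases hadj c d hcd with ⟨c', d', h4, h5, h6⟩ | ⟨c', h4, h5, h6⟩ <;>
    rw [h2, h5] at hne ⊢ <;> rw [h3] at hz <;> rw [h6] at hz' <;> simp only [Sym2.mem_iff]
    · obtain ⟨w, hw1, hw2, hw3⟩ := h.eq_of_mem_mem _ _ _ _ h1 h4 (by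
        intro e
        refine hne ?_
        simpa using congrArg (Sym2.map some) e) z hz hz'
      exact ⟨some w, by simpa using hw1, by simpa using hw2, hw3⟩
    · obtain ⟨e1, e2⟩ := hnew1 c' h4 _ _ h1 z hz' hz
      exact ⟨some c', by simpa using e2, by simp, e1⟩
    · obtain ⟨e1, e2⟩ := hnew1 a' h1 _ _ h4 z hz hz'
      exact ⟨some a', by simp, by simpa using e2, e1⟩
    · exact ⟨none, by simp, by simp, hnew3 a' c' h1 h4 (fun e => hne (by rw [e])) z hz hz'⟩

end PlaneGraph

namespace ColoredMixedGraph

/-! ### Letters and words -/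

/-- The ways in which two vertices can be adjacent: along an arc of a given color, forwards (`true`)
or backwards (`false`), or along an edge of a given color. -/
abbrev Letter (m n : ℕ) : Type := (Fin m × Bool) ⊕ Fin n

/-- The adjacency seen from the other end. -/
def Letter.inv {m n : ℕ} : Letter m n → Letter m n
  | .inl (i, b) => .inl (i, !b)
  | .inr j => .inr j

@[simp] lemma Letter.inv_inv {m n : ℕ} (t : Letter m n) : t.inv.inv = t := by
  rcases t with ⟨i, b⟩ | j <;> simp [Letter.inv]

variable {m n : ℕ} {U V W : Type*}

/-- `G.Step t u v`: the vertex `v` is adjacent to `u` in the way `t`. -/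
def Step (G : ColoredMixedGraph m n V) : Letter m n → V → V → Prop
  | .inl (i, true), u, v => G.Arc i u v
  | .inl (i, false), u, v => G.Arc i v u
  | .inr j, u, v => G.Edge j u v

lemma step_inv (G : ColoredMixedGraph m n V) (t : Letter m n) (u v : V) :
    G.Step t.inv u v ↔ G.Step t v u := by
  rcases t with ⟨i, _ | _⟩ | j
  · exact Iff.rfl
  · exact Iff.rfl
  · exact ⟨G.edge_symm j u v, G.edge_symm j v u⟩

lemma step_irrefl (G : ColoredMixedGraph m n V) (t : Letter m n) (u : V) : ¬ G.Step t u u := by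
  rcases t with ⟨i, _ | _⟩ | j
  · exact G.arc_loopless i u
  · exact G.arc_loopless i u
  · exact G.edge_loopless j u

lemma step_unique (G : ColoredMixedGraph m n V) {t t' : Letter m n} {u v : V} (h : G.Step t u v)
    (h' : G.Step t' u v) : t = t' := by
  rcases t with ⟨i, _ | _⟩ | j <;> rcases t' with ⟨i', _ | _⟩ | j'
  · rw [G.arc_unique i i' _ _ h h']
  · exact absurd h' (G.arc_asymm i i' _ _ h)
  · exact absurd (G.edge_symm _ _ _ h') (G.arc_not_edge i j' _ _ h)
  · exact absurd h' (G.arc_asymm i i' _ _ h)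
  · rw [G.arc_unique i i' _ _ h h']
  · exact absurd h' (G.arc_not_edge i j' _ _ h)
  · exact absurd (G.edge_symm _ _ _ h) (G.arc_not_edge i' j _ _ h')
  · exact absurd h (G.arc_not_edge i' j _ _ h')
  · rw [G.edge_unique j j' _ _ h h']

lemma underlying_adj (G : ColoredMixedGraph m n V) {u v : V} :
    G.underlying.Adj u v ↔ ∃ t, G.Step t u v := by
  constructor
  · rintro (⟨i, h⟩ | ⟨i, h⟩ | ⟨j, h⟩)
    · exact ⟨.inl (i, true), h⟩
    · exact ⟨.inl (i, false), h⟩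
    · exact ⟨.inr j, h⟩
  · rintro ⟨⟨i, _ | _⟩ | j, h⟩
    · exact Or.inr (Or.inl ⟨i, h⟩)
    · exact Or.inl ⟨i, h⟩
    · exact Or.inr (Or.inr ⟨j, h⟩)

lemma isHom_iff {G : ColoredMixedGraph m n V} {H : ColoredMixedGraph m n W} {φ : V → W} :
    G.IsHom H φ ↔ ∀ t u v, G.Step t u v → H.Step t (φ u) (φ v) := by
  constructor
  · rintro ⟨h1, h2⟩ (⟨i, _ | _⟩ | j) u v h
    · exact h1 i v u h
    · exact h1 i u v h
    · exact h2 j u v h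
  · intro h
    exact ⟨fun i u v => h (.inl (i, true)) u v, fun j u v => h (.inr j) u v⟩

lemma IsHom.adj {G : ColoredMixedGraph m n V} {H : ColoredMixedGraph m n W} {φ : V → W}
    (h : G.IsHom H φ) {u v : V} (huv : G.underlying.Adj u v) : H.underlying.Adj (φ u) (φ v) := by
  obtain ⟨t, ht⟩ := G.underlying_adj.1 huv
  exact H.underlying_adj.2 ⟨t, isHom_iff.1 h t u v ht⟩

/-- The colored-mixed graph given by its adjacencies in the various ways. -/
def ofStep (S : Letter m n → V → V → Prop) (hinv : ∀ t u v, S t u v → S t.inv v u)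
    (hirr : ∀ t u, ¬ S t u u) (huniq : ∀ t t' u v, S t u v → S t' u v → t = t') :
    ColoredMixedGraph m n V where
  Arc i := S (.inl (i, true))
  Edge j := S (.inr j)
  edge_symm j u v h := hinv _ _ _ h
  arc_loopless i := hirr _
  edge_loopless j := hirr _
  arc_unique i i' u v h h' := by simpa using huniq _ _ _ _ h h'
  arc_asymm i i' u v h h' := by simpa [Letter.inv] using huniq _ _ _ _ h (hinv _ _ _ h')
  edge_unique j j' u v h h' := by simpa using huniq _ _ _ _ h h'
  arc_not_edge i j u v h h' := by simpa using huniq _ _ _ _ h h'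

lemma ofStep_step {S : Letter m n → V → V → Prop} {hinv : ∀ t u v, S t u v → S t.inv v u}
    {hirr : ∀ t u, ¬ S t u u} {huniq : ∀ t t' u v, S t u v → S t' u v → t = t'}
    {t : Letter m n} {u v : V} : (ofStep S hinv hirr huniq).Step t u v ↔ S t u v := by
  rcases t with ⟨i, _ | _⟩ | j
  · exact ⟨fun h => hinv (.inl (i, true)) _ _ h, fun h => hinv _ _ _ h⟩
  · exact Iff.rfl
  · exact Iff.rfl

/-- There is a walk from `u` to `v` whose successive adjacencies spell the given word. -/
def Spells (G : ColoredMixedGraph m n V) : List (Letter m n) → V → V → Prop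
  | [], u, v => u = v
  | t :: w, u, v => ∃ x, G.Step t u x ∧ G.Spells w x v

lemma Spells.map {G : ColoredMixedGraph m n V} {H : ColoredMixedGraph m n W} {φ : V → W}
    (h : G.IsHom H φ) {w : List (Letter m n)} {u v : V} (hw : G.Spells w u v) :
    H.Spells w (φ u) (φ v) := by
  induction w generalizing u with
  | nil => exact congrArg φ hw
  | cons t w ih =>
    obtain ⟨x, h1, h2⟩ := hw
    exact ⟨φ x, isHom_iff.1 h t u x h1, ih h2⟩

/-! ### Enlarging and restricting colored-mixed graphs -/

/-- The graph `G` with a new isolated vertex. -/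
def addVertex (G : ColoredMixedGraph m n V) : ColoredMixedGraph m n (Option V) :=
  ofStep (fun t u v => ∃ u' v', u = some u' ∧ v = some v' ∧ G.Step t u' v')
    (by
      rintro t _ _ ⟨u, v, rfl, rfl, h⟩
      exact ⟨v, u, rfl, rfl, (G.step_inv t v u).2 h⟩)
    (by
      rintro t _ ⟨u, v, rfl, h, h'⟩
      rw [Option.some.inj h] at h'
      exact G.step_irrefl t v h')
    (by
      rintro t t' _ _ ⟨u, v, rfl, rfl, h⟩ ⟨u', v', h1, h2, h'⟩
      rw [← Option.some.inj h1, ← Option.some.inj h2] at h'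
      exact G.step_unique h h')

lemma addVertex_adj (G : ColoredMixedGraph m n V) {u v : Option V} :
    G.addVertex.underlying.Adj u v ↔
      ∃ u' v', u = some u' ∧ v = some v' ∧ G.underlying.Adj u' v' := by
  simp only [underlying_adj, addVertex, ofStep_step]
  constructor
  · rintro ⟨t, u', v', h1, h2, h3⟩; exact ⟨u', v', h1, h2, t, h3⟩
  · rintro ⟨u', v', h1, h2, t, h3⟩; exact ⟨t, u', v', h1, h2, h3⟩

lemma isHom_addVertex (G : ColoredMixedGraph m n V) : G.IsHom G.addVertex some :=
  isHom_iff.2 fun _ u v h => ofStep_step.2 ⟨u, v, rfl, rfl, h⟩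

/-- The graph `G` with an adjacency of type `t` from `x` to `y`, which were not adjacent. -/
def addStep (G : ColoredMixedGraph m n V) (t : Letter m n) {x y : V} (hne : x ≠ y)
    (hxy : ¬ G.underlying.Adj x y) : ColoredMixedGraph m n V :=
  ofStep (fun t' u v => G.Step t' u v ∨ (t' = t ∧ u = x ∧ v = y) ∨ (t' = t.inv ∧ u = y ∧ v = x))
    (by
      rintro t' u v (h | ⟨rfl, rfl, rfl⟩ | ⟨rfl, rfl, rfl⟩)
      · exact Or.inl ((G.step_inv t' v u).2 h)
      · exact Or.inr (Or.inr ⟨rfl, rfl, rfl⟩)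
      · exact Or.inr (Or.inl ⟨t.inv_inv, rfl, rfl⟩))
    (by
      rintro t' u (h | ⟨-, h1, h2⟩ | ⟨-, h1, h2⟩)
      · exact G.step_irrefl t' u h
      · exact hne (h1.symm.trans h2)
      · exact hne (h2.symm.trans h1))
    (by
      have hxy' : ∀ t, ¬ G.Step t x y := fun t h => hxy (G.underlying_adj.2 ⟨t, h⟩)
      have hyx : ∀ t, ¬ G.Step t y x := fun t h =>
        hxy (G.underlying_adj.2 ⟨t, h⟩).symm
      rintro t' t'' u v (h | ⟨rfl, rfl, rfl⟩ | ⟨rfl, rfl, rfl⟩)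
        (h' | ⟨rfl, h1, h2⟩ | ⟨rfl, h1, h2⟩)
      · exact G.step_unique h h'
      · subst h1 h2; exact absurd h (hxy' _)
      · subst h1 h2; exact absurd h (hyx _)
      · exact absurd h' (hxy' _)
      · rfl
      · exact absurd h1 hne
      · exact absurd h' (hyx _)
      · exact absurd h2 hne
      · rfl)

lemma addStep_step (G : ColoredMixedGraph m n V) {t t' : Letter m n} {x y u v : V} {hne : x ≠ y}
    {hxy : ¬ G.underlying.Adj x y} : (G.addStep t hne hxy).Step t' u v ↔
      G.Step t' u v ∨ (t' = t ∧ u = x ∧ v = y) ∨ (t' = t.inv ∧ u = y ∧ v = x) := ofStep_step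

lemma addStep_adj (G : ColoredMixedGraph m n V) {t : Letter m n} {x y u v : V} {hne : x ≠ y}
    {hxy : ¬ G.underlying.Adj x y} : (G.addStep t hne hxy).underlying.Adj u v ↔
      G.underlying.Adj u v ∨ s(u, v) = s(x, y) := by
  simp only [underlying_adj, addStep_step, Sym2.eq_iff]
  constructor
  · rintro ⟨t', h | ⟨-, h⟩ | ⟨-, h⟩⟩
    · exact Or.inl ⟨t', h⟩
    · exact Or.inr (Or.inl h)
    · exact Or.inr (Or.inr h)
  · rintro (⟨t', h⟩ | h | h)
    · exact ⟨t', Or.inl h⟩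
    · exact ⟨t, Or.inr (Or.inl ⟨rfl, h⟩)⟩
    · exact ⟨t.inv, Or.inr (Or.inr ⟨rfl, h⟩)⟩

/-- The graph `G` without the adjacency of `a` and `b`. -/
def deletePair (G : ColoredMixedGraph m n V) (a b : V) : ColoredMixedGraph m n V :=
  ofStep (fun t u v => G.Step t u v ∧ s(u, v) ≠ s(a, b))
    (fun t u v h => ⟨(G.step_inv t v u).2 h.1, by rw [Sym2.eq_swap]; exact h.2⟩)
    (fun t u h => G.step_irrefl t u h.1) (fun _ _ _ _ h h' => G.step_unique h.1 h'.1)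

lemma deletePair_step (G : ColoredMixedGraph m n V) {a b u v : V} {t : Letter m n} :
    (G.deletePair a b).Step t u v ↔ G.Step t u v ∧ s(u, v) ≠ s(a, b) := ofStep_step

/-- The colored-mixed graph that a map into a colored-mixed graph induces on its domain. -/
def comap (G : ColoredMixedGraph m n W) (f : V → W) : ColoredMixedGraph m n V :=
  ofStep (fun t u v => G.Step t (f u) (f v)) (fun t _ _ h => (G.step_inv t _ _).2 h)
    (fun t u h => G.step_irrefl t (f u) h) (fun _ _ _ _ h h' => G.step_unique h h')

lemma comap_step (G : ColoredMixedGraph m n W) {f : V → W} {t : Letter m n} {u v : V} :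
    (G.comap f).Step t u v ↔ G.Step t (f u) (f v) := ofStep_step

/-! ### Girth of enlarged graphs -/

lemma _root_.SimpleGraph.Walk.exists_eq_append_of_mem_darts {G : SimpleGraph V} {u v : V}
    (p : G.Walk u v) (d : G.Dart) (hd : d ∈ p.darts) :
    ∃ (q : G.Walk u d.fst) (r : G.Walk d.snd v), p = q.append (.cons d.adj r) := by
  induction p with
  | nil => simp at hd
  | cons h p ih =>
    rw [SimpleGraph.Walk.darts_cons, List.mem_cons] at hd
    rcases hd with rfl | hd
    · exact ⟨.nil, p, rfl⟩
    · obtain ⟨q, r, rfl⟩ := ih hd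
      exact ⟨.cons h q, r, rfl⟩

/-- A cycle through a new edge `xy` consists of this edge and a walk from `x` to `y`. -/
lemma le_egirth_addStep {G : ColoredMixedGraph m n V} {t : Letter m n} {x y : V} {hne : x ≠ y}
    {hxy : ¬ G.underlying.Adj x y} {g : ℕ} (hg : (g : ℕ∞) ≤ G.underlying.egirth)
    (hw : ∀ p : G.underlying.Walk x y, g ≤ p.length + 1) :
    (g : ℕ∞) ≤ (G.addStep t hne hxy).underlying.egirth := by
  rw [SimpleGraph.le_egirth] at hg ⊢
  intro a c hc
  have hedge : ∀ e ∈ (G.addStep t hne hxy).underlying.edgeSet, e ≠ s(x, y) →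
      e ∈ G.underlying.edgeSet := by
    intro e he hexy
    induction e with
    | h u v => exact ((addStep_adj G).1 he).resolve_right hexy
  by_cases hmem : s(x, y) ∈ c.edges
  · obtain ⟨d, hd, hde⟩ := List.mem_map.1 hmem
    obtain ⟨q, r, rfl⟩ := c.exists_eq_append_of_mem_darts d hd
    have hnd := hc.edges_nodup
    rw [SimpleGraph.Walk.edges_append, SimpleGraph.Walk.edges_cons, List.nodup_append] at hnd
    have hd' : s(d.fst, d.snd) = s(x, y) := hde
    have hq : s(x, y) ∉ q.edges := fun h => hnd.2.2 _ h _ (List.mem_cons_self ..) hd'.symm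
    have hr : s(x, y) ∉ r.edges := fun h => (List.nodup_cons.1 hnd.2.1).1 (hd' ▸ h)
    have hrq : ∀ e ∈ (r.append q).edges, e ∈ G.underlying.edgeSet := by
      intro e he
      refine hedge e ((r.append q).edges_subset_edgeSet he) ?_
      rintro rfl
      rw [SimpleGraph.Walk.edges_append, List.mem_append] at he
      exact he.elim hr hq
    have hlen : ((r.append q).transfer _ hrq).length + 1 =
        (q.append (.cons d.adj r)).length := by
      simp only [SimpleGraph.Walk.length_transfer, SimpleGraph.Walk.length_append,
        SimpleGraph.Walk.length_cons]
      omega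
    rw [← hlen]
    rcases Sym2.eq_iff.1 hd' with ⟨h1, h2⟩ | ⟨h1, h2⟩
    · have := hw (((r.append q).transfer _ hrq).reverse.copy h1 h2)
      rw [SimpleGraph.Walk.length_copy, SimpleGraph.Walk.length_reverse] at this
      exact_mod_cast this
    · have := hw (((r.append q).transfer _ hrq).copy h2 h1)
      rw [SimpleGraph.Walk.length_copy] at this
      exact_mod_cast this
  · have hc' := hc.transfer (H := G.underlying) fun e he =>
      hedge e (c.edges_subset_edgeSet he) fun h => hmem (h ▸ he)
    simpa using hg a _ hc'

/-- No cycle visits an isolated vertex. -/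
lemma le_egirth_addVertex {G : ColoredMixedGraph m n V} {g : ℕ}
    (hg : (g : ℕ∞) ≤ G.underlying.egirth) : (g : ℕ∞) ≤ G.addVertex.underlying.egirth := by
  rw [SimpleGraph.le_egirth] at hg ⊢
  intro a c hc
  have hsupp : ∀ v ∈ c.support, v ∈ {v : Option V | v.isSome} := by
    intro v hv
    obtain ⟨e, he, hve⟩ := (SimpleGraph.Walk.mem_support_iff_exists_mem_edges_of_not_nil
      hc.not_nil).1 hv
    have he' := c.edges_subset_edgeSet he
    induction e with
    | h u w =>
      obtain ⟨u', w', rfl, rfl, -⟩ := (addVertex_adj G).1 he'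
      rcases Sym2.mem_iff.1 hve with rfl | rfl <;> simp
  let f : G.addVertex.underlying.induce {v : Option V | v.isSome} →g G.underlying :=
    { toFun := fun v => v.1.get v.2
      map_rel' := by
        rintro ⟨u, hu⟩ ⟨v, hv⟩ h
        obtain ⟨u', v', rfl, rfl, h'⟩ := (addVertex_adj G).1 h
        exact h' }
  have hf : Function.Injective f := by
    rintro ⟨u, hu⟩ ⟨v, hv⟩ h
    exact Subtype.ext (Option.get_inj.1 h)
  have h1 : (c.induce _ hsupp).IsCycle := by
    refine SimpleGraph.Walk.IsCycle.of_map (f := (SimpleGraph.Embedding.induce _).toHom) ?_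
    rw [SimpleGraph.Walk.map_induce]
    exact hc
  have h2 := hg _ _ (h1.map hf)
  have h3 : ((c.induce _ hsupp).map f).length = c.length := by
    rw [SimpleGraph.Walk.length_map]
    exact (SimpleGraph.Walk.length_map _ _).symm.trans
      (congrArg SimpleGraph.Walk.length (SimpleGraph.Walk.map_induce c hsupp))
  rwa [h3] at h2

/-! ### Adding ears -/

open PlaneGraph

/-- The graph `G` has girth at least `g` and is a subgraph of the graph `H`, which has a drawing with
straight edges. The graph `H` contains additional edges along which `G` can be enlarged. -/
structure IsSketch (g : ℕ) (G : ColoredMixedGraph m n V) (H : SimpleGraph V) : Prop where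
  le : G.underlying ≤ H
  exists_drawing : ∃ x, IsStraightDrawing H x
  girth : (g : ℕ∞) ≤ G.underlying.egirth

lemma IsSketch.isPlanarOfGirthAtLeast {g : ℕ} {G : ColoredMixedGraph m n V} {H : SimpleGraph V}
    (h : IsSketch g G H) : G.IsPlanarOfGirthAtLeast g :=
  let ⟨_, hx⟩ := h.exists_drawing
  ⟨⟨hx.planeDrawing h.le⟩, h.girth⟩

lemma IsSketch.addVertex [Finite V] {g : ℕ} {G : ColoredMixedGraph m n V} {H : SimpleGraph V}
    (h : IsSketch g G H) {u v : V} (huv : H.Adj u v) :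
    IsSketch g G.addVertex (apexGraph H u v) := by
  refine ⟨?_, ?_, le_egirth_addVertex h.girth⟩
  · intro a b hab
    obtain ⟨a', b', rfl, rfl, hab'⟩ := (addVertex_adj G).1 hab
    exact apexGraph_adj_some.2 (h.le hab')
  · obtain ⟨x, hx⟩ := h.exists_drawing
    exact hx.exists_apexGraph huv

lemma IsSketch.addStep {g : ℕ} {G : ColoredMixedGraph m n V} {H : SimpleGraph V}
    (h : IsSketch g G H) (t : Letter m n) {x y : V} (hH : H.Adj x y)
    (hxy : ¬ G.underlying.Adj x y) (hw : ∀ p : G.underlying.Walk x y, g ≤ p.length + 1) :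
    IsSketch g (G.addStep t hH.ne hxy) H := by
  refine ⟨fun u v huv => ?_, h.exists_drawing, le_egirth_addStep h.girth hw⟩
  rcases (addStep_adj G).1 huv with h' | h'
  · exact h.le h'
  · rcases Sym2.eq_iff.1 h' with ⟨rfl, rfl⟩ | ⟨rfl, rfl⟩
    · exact hH
    · exact hH.symm

lemma isHom_addStep (G : ColoredMixedGraph m n V) {t : Letter m n} {x y : V} {hne : x ≠ y}
    {hxy : ¬ G.underlying.Adj x y} : G.IsHom (G.addStep t hne hxy) id :=
  isHom_iff.2 fun _ _ _ h => (addStep_step G).2 (Or.inl h)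

lemma IsHom.comp {G : ColoredMixedGraph m n U} {H : ColoredMixedGraph m n V}
    {K : ColoredMixedGraph m n W} {φ : U → V} {ψ : V → W} (h : H.IsHom K ψ) (h' : G.IsHom H φ) :
    G.IsHom K (ψ ∘ φ) :=
  isHom_iff.2 fun t u v huv => isHom_iff.1 h t _ _ (isHom_iff.1 h' t u v huv)

lemma le_add_length_of_lipschitz {G : SimpleGraph V} {f : V → ℕ}
    (hf : ∀ a b, G.Adj a b → f a ≤ f b + 1) {u v : V} (p : G.Walk u v) :
    f u ≤ f v + p.length := by
  induction p with
  | nil => simp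
  | cons h p ih =>
    have := hf _ _ h
    rw [SimpleGraph.Walk.length_cons]
    omega

/-- A word can be spelled along a new path from `x` to `v` near the edge `xv` of `H`. The function
`f` bounds distances to `v` from below; it keeps the girth large. -/
lemma IsSketch.exists_ear {g : ℕ} (hg : 3 ≤ g) (w : List (Letter m n)) (hw : w ≠ []) {V : Type}
    [Finite V] {G : ColoredMixedGraph m n V} {H : SimpleGraph V} (h : IsSketch g G H) {x v : V}
    (hxv : H.Adj x v) (f : V → ℕ) (hf : ∀ a b, G.underlying.Adj a b → f a ≤ f b + 1)
    (hfv : f v = 0) (hfx : g ≤ f x + w.length) :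
    ∃ (V' : Type) (_ : Finite V') (G' : ColoredMixedGraph m n V') (H' : SimpleGraph V')
      (ι : V → V'), IsSketch g G' H' ∧ G.IsHom G' ι ∧ G'.Spells w (ι x) (ι v) := by
  induction w generalizing V with
  | nil => exact absurd rfl hw
  | cons t w ih =>
    rcases w with _ | ⟨t', w⟩
    · have hnadj : ¬ G.underlying.Adj x v := fun hadj => by
        have := hf _ _ hadj
        simp at hfx
        omega
      refine ⟨V, inferInstance, G.addStep t hxv.ne hnadj, H, id, h.addStep t hxv hnadj ?_,
        G.isHom_addStep, v, (addStep_step G).2 (Or.inr (Or.inl ⟨rfl, rfl, rfl⟩)), rfl⟩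
      intro p
      have := le_add_length_of_lipschitz hf p
      simp at hfx
      omega
    · have hH1 : (apexGraph H x v).Adj (some x) none := (apexGraph_adj_none.2 (Or.inl rfl)).symm
      have hno : ∀ p : G.addVertex.underlying.Walk (some x) none, False := by
        intro p
        rcases p.reverse with _ | ⟨h, -⟩
        obtain ⟨_, _, h, -⟩ := (addVertex_adj G).1 h
        exact absurd h (by simp)
      have hnadj : ¬ G.addVertex.underlying.Adj (some x) none := fun h => hno (.cons h .nil)
      have h2 := (h.addVertex hxv).addStep t hH1 hnadj fun p => (hno p).elim
      set G₂ := G.addVertex.addStep t hH1.ne hnadj with hG₂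
      obtain ⟨V', hV', G', H', ι, h3, h4, h5⟩ := ih (by simp) h2
        (apexGraph_adj_none.2 (Or.inr rfl)) (fun o => o.elim (f x + 1) f)
        (by
          intro a b hab
          rcases (addStep_adj _).1 hab with h | h
          · obtain ⟨a', b', rfl, rfl, h'⟩ := (addVertex_adj G).1 h
            exact hf a' b' h'
          · rcases Sym2.eq_iff.1 h with ⟨rfl, rfl⟩ | ⟨rfl, rfl⟩
            · simp only [Option.elim]; omega
            · simp only [Option.elim]; omega)
        hfv (by simp only [List.length_cons, Option.elim] at hfx ⊢; omega)
      have h6 : G.IsHom G₂ some := (isHom_addStep _).comp G.isHom_addVertex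
      refine ⟨V', hV', G', H', ι ∘ some, h3, h4.comp h6, ι none, ?_, h5⟩
      exact isHom_iff.1 h4 _ _ _ ((addStep_step _).2 (Or.inr (Or.inl ⟨rfl, rfl, rfl⟩)))

/-- A sketch can be enlarged so that a given long word is spelled by a walk between any two vertices
that were adjacent. -/
lemma IsSketch.exists_enrichment {g : ℕ} (hg : 3 ≤ g) (w : List (Letter m n)) (hw : g ≤ w.length)
    {V : Type} [Finite V] {G : ColoredMixedGraph m n V} {H : SimpleGraph V} (h : IsSketch g G H) :
    ∃ (V' : Type) (_ : Finite V') (G' : ColoredMixedGraph m n V') (H' : SimpleGraph V')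
      (ι : V → V'), IsSketch g G' H' ∧ G.IsHom G' ι ∧
        ∀ u v, G.underlying.Adj u v → G'.Spells w (ι u) (ι v) := by
  classical
  have := Fintype.ofFinite V
  suffices key : ∀ s : Finset (V × V), ∃ (V' : Type) (_ : Finite V')
      (G' : ColoredMixedGraph m n V') (H' : SimpleGraph V') (ι : V → V'), IsSketch g G' H' ∧
        G.IsHom G' ι ∧ ∀ u v, (u, v) ∈ s → G.underlying.Adj u v → G'.Spells w (ι u) (ι v) by
    obtain ⟨V', hV', G', H', ι, h1, h2, h3⟩ := key Finset.univ
    exact ⟨V', hV', G', H', ι, h1, h2, fun u v => h3 u v (Finset.mem_univ _)⟩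
  intro s
  induction s using Finset.induction with
  | empty => exact ⟨V, inferInstance, G, H, id, h, isHom_iff.2 fun _ _ _ h => h, by simp⟩
  | insert p s _ ih =>
    obtain ⟨V₁, hV₁, G₁, H₁, ι₁, h1, h2, h3⟩ := ih
    by_cases hp : G.underlying.Adj p.1 p.2
    · obtain ⟨V₂, hV₂, G₂, H₂, ι₂, h4, h5, h6⟩ := h1.exists_ear hg w
        (fun e => by simp [e] at hw; omega) (h1.le (h2.adj hp)) (fun _ => 0) (by simp) rfl
        (by simpa using hw)
      refine ⟨V₂, hV₂, G₂, H₂, ι₂ ∘ ι₁, h4, h5.comp h2, fun u v huv hadj => ?_⟩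
      rcases Finset.mem_insert.1 huv with rfl | huv
      · exact h6
      · exact (h3 u v huv hadj).map h5
    · refine ⟨V₁, hV₁, G₁, H₁, ι₁, h1, h2, fun u v huv hadj => ?_⟩
      rcases Finset.mem_insert.1 huv with rfl | huv
      · exact absurd hadj hp
      · exact h3 u v huv hadj

/-- There is a sketch with an adjacency of any given type. -/
lemma exists_isSketch_step (g : ℕ) (t : Letter m n) :
    ∃ (G : ColoredMixedGraph m n Bool) (H : SimpleGraph Bool), IsSketch g G H ∧
      G.Step t false true := by
  let G₀ : ColoredMixedGraph m n Bool := ofStep (fun _ _ _ => False) (by simp) (by simp) (by simp)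
  have h0 : ∀ a b, ¬ G₀.underlying.Adj a b := fun a b h => by
    obtain ⟨t, ht⟩ := G₀.underlying_adj.1 h
    exact ofStep_step.1 ht
  have hno : ∀ p : G₀.underlying.Walk false true, False := by
    rintro (_ | ⟨h, -⟩)
    exact h0 _ _ h
  have hs : IsSketch g G₀ ⊤ := by
    refine ⟨le_top, ⟨fun b => !₂[if b then 1 else 0, 0], ⟨?_, ?_, ?_⟩⟩, ?_⟩
    · intro a b hab
      have := congrArg (fun p : Plane => p 0) hab
      cases a <;> cases b <;> simp at this ⊢
    · intro a b hab w _
      cases a <;> cases b <;> cases w <;> simp at hab ⊢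
    · intro a b c d hab hcd hne
      cases a <;> cases b <;> cases c <;> cases d <;> simp at hab hcd hne
    · rw [SimpleGraph.le_egirth]
      rintro a (_ | ⟨h, -⟩) hc
      · exact absurd rfl hc.ne_nil
      · exact absurd h (h0 _ _)
  exact ⟨_, _, hs.addStep t (by simp) (h0 false true) fun p => (hno p).elim,
    (addStep_step _).2 (Or.inr (Or.inl ⟨rfl, rfl, rfl⟩))⟩

/-! ### Minimal targets -/

/-- The graph `X` is a target for all sketches of girth at least `g`. -/
def IsTarget {W : Type*} (g : ℕ) (X : ColoredMixedGraph m n W) : Prop :=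
  ∀ (U : Type) [Finite U] (G : ColoredMixedGraph m n U) (H : SimpleGraph U),
    IsSketch g G H → ∃ φ : U → W, G.IsHom X φ

/-- Between any two adjacent vertices, each word of length at least `g` is spelled by a walk. -/
def IsSaturated {W : Type*} (g : ℕ) (X : ColoredMixedGraph m n W) : Prop :=
  ∀ u v, X.underlying.Adj u v → ∀ w : List (Letter m n), g ≤ w.length → X.Spells w u v

/-- In a target with the fewest adjacencies every long word is spelled between any two adjacent
vertices. If some word were not spelled from `u` to `v`, a sketch without homomorphism into the graph
in which `u` and `v` are no longer adjacent could be enriched by this word. -/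
theorem exists_isSaturated_target {W : Type} [Finite W] {g : ℕ} (hg : 3 ≤ g)
    (T : ColoredMixedGraph m n W) (hT : T.IsTarget g) :
    ∃ X : ColoredMixedGraph m n W, X.IsTarget g ∧ X.underlying ≤ T.underlying ∧
      X.IsSaturated g := by
  obtain ⟨X, ⟨hX, hXT⟩, hmin⟩ := exists_minimalFor_of_wellFoundedLT
    (fun X : ColoredMixedGraph m n W => X.IsTarget g ∧ X.underlying ≤ T.underlying)
    (fun X => X.underlying.edgeSet.ncard) ⟨T, hT, le_rfl⟩
  refine ⟨X, hX, hXT, fun u v huv w hw => ?_⟩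
  have hle : (X.deletePair u v).underlying ≤ X.underlying := by
    intro a b hab
    obtain ⟨t, ht⟩ := (underlying_adj _).1 hab
    exact X.underlying_adj.2 ⟨t, (X.deletePair_step.1 ht).1⟩
  have hlt : (X.deletePair u v).underlying.edgeSet.ncard < X.underlying.edgeSet.ncard := by
    refine Set.ncard_lt_ncard ⟨SimpleGraph.edgeSet_mono hle, fun h => ?_⟩ (Set.toFinite _)
    have h' : (X.deletePair u v).underlying.Adj u v := h (show s(u, v) ∈ _ from huv)
    obtain ⟨t, ht⟩ := (underlying_adj _).1 h'
    exact (X.deletePair_step.1 ht).2 rfl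
  have hno : ¬ (X.deletePair u v).IsTarget g := fun h =>
    (hmin ⟨h, hle.trans hXT⟩ hlt.le).not_gt hlt
  unfold IsTarget at hno
  push Not at hno
  obtain ⟨U, hU, G, H, hs, hno⟩ := hno
  obtain ⟨U', hU', G', H', ι, hs', hι, hsp⟩ := hs.exists_enrichment hg w hw
  obtain ⟨φ, hφ⟩ := hX U' G' H' hs'
  have hcomp := hφ.comp hι
  have hno := hno (φ ∘ ι)
  rw [isHom_iff] at hno
  push Not at hno
  obtain ⟨t, a, b, hab, hnab⟩ := hno
  have hstep := isHom_iff.1 hcomp t a b hab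
  have heq : s((φ ∘ ι) a, (φ ∘ ι) b) = s(u, v) := by
    by_contra h
    exact hnab (X.deletePair_step.2 ⟨hstep, h⟩)
  have hadj := G.underlying_adj.2 ⟨t, hab⟩
  rcases Sym2.eq_iff.1 heq with ⟨rfl, rfl⟩ | ⟨rfl, rfl⟩
  · exact (hsp a b hadj).map hφ
  · exact (hsp b a hadj.symm).map hφ

/-! ### Counting the edges of a target -/

section Counting

variable {V : Type*} {g : ℕ} {X : ColoredMixedGraph m n V}

/-- The graph of the edges of color `j`. -/
def edgeGraph (X : ColoredMixedGraph m n V) (j : Fin n) : SimpleGraph V where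
  Adj := X.Edge j
  symm := ⟨X.edge_symm j⟩
  loopless := ⟨X.edge_loopless j⟩

/-- The bipartite double of the arcs of color `i`: each vertex has an out-copy `(u, true)` and an
in-copy `(u, false)`, and each arc joins the out-copy of its tail to the in-copy of its head. -/
def arcDouble (X : ColoredMixedGraph m n V) (i : Fin m) : SimpleGraph (V × Bool) where
  Adj p q := p.2 ≠ q.2 ∧ X.Step (.inl (i, p.2)) p.1 q.1
  symm := by
    constructor
    rintro ⟨u, b⟩ ⟨v, b'⟩ ⟨h, h'⟩
    refine ⟨h.symm, ?_⟩
    have hb : b' = !b := by cases b <;> cases b' <;> simp_all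
    subst hb
    exact (X.step_inv (.inl (i, b)) v u).2 h'
  loopless := ⟨fun _ h => h.1 rfl⟩

/-- The word of length `k` that follows arcs of color `i` alternately in both directions. -/
def alternatingWord (i : Fin m) : ℕ → Bool → List (Letter m n)
  | 0, _ => []
  | k + 1, b => .inl (i, b) :: alternatingWord i k (!b)

lemma length_alternatingWord (i : Fin m) (k : ℕ) (b : Bool) :
    (alternatingWord (n := n) i k b).length = k := by
  induction k generalizing b with
  | zero => rfl
  | succ k ih => simp [alternatingWord, ih]

lemma reachable_edgeGraph {j : Fin n} {k : ℕ} {u v : V}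
    (h : X.Spells (List.replicate k (.inr j)) u v) : (X.edgeGraph j).Reachable u v := by
  induction k generalizing u with
  | zero => exact h ▸ .rfl
  | succ k ih =>
    obtain ⟨x, h1, h2⟩ := h
    exact (show (X.edgeGraph j).Adj u x from h1).reachable.trans (ih h2)

lemma reachable_arcDouble {i : Fin m} {k : ℕ} {b : Bool} {u v : V}
    (h : X.Spells (alternatingWord i k b) u v) :
    (X.arcDouble i).Reachable (u, b) (v, if Even k then b else !b) := by
  induction k generalizing u b with
  | zero => obtain rfl : u = v := h; simp
  | succ k ih =>
    obtain ⟨x, h1, h2⟩ := h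
    have h3 : (X.arcDouble i).Adj (u, b) (x, !b) := ⟨by simp, h1⟩
    have h4 := h3.reachable.trans (ih h2)
    by_cases hk : Even k
    · simpa [hk, Nat.even_add_one] using h4
    · simpa [hk, Nat.even_add_one] using h4

lemma edgeGraph_connected (hX : X.IsSaturated g) (hc : X.underlying.Connected) (j : Fin n) :
    (X.edgeGraph j).Connected := by
  have := hc.nonempty
  refine ⟨fun u v => ?_⟩
  obtain ⟨p⟩ := hc.preconnected u v
  induction p with
  | nil => exact .rfl
  | cons h p ih =>
    exact (reachable_edgeGraph (hX _ _ h (List.replicate g (.inr j)) (by simp))).trans ih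

lemma arcDouble_connected (hX : X.IsSaturated g) (hc : X.underlying.Connected)
    (hnb : ∀ u, ∃ v, X.underlying.Adj u v) (i : Fin m) : (X.arcDouble i).Connected := by
  obtain ⟨u₀⟩ := hc.nonempty
  -- words of both parities lead from either copy of a vertex to both copies of its neighbors
  have hadj : ∀ u v, X.underlying.Adj u v → ∀ b b', (X.arcDouble i).Reachable (u, b) (v, b') := by
    intro u v huv b b'
    have h1 := reachable_arcDouble (hX u v huv (alternatingWord i (2 * g) b)
      (by rw [length_alternatingWord]; omega))
    have h2 := reachable_arcDouble (hX u v huv (alternatingWord i (2 * g + 1) b)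
      (by rw [length_alternatingWord]; omega))
    rw [if_pos (by simp)] at h1
    rw [if_neg (by simp)] at h2
    rcases Bool.eq_or_eq_not b' b with rfl | rfl
    · exact h1
    · exact h2
  have hwalk : ∀ u v, X.underlying.Walk u v → ∀ b, (X.arcDouble i).Reachable (u, b) (v, b) := by
    intro u v p b
    induction p with
    | nil => exact .rfl
    | cons h p ih => exact (hadj _ _ h b b).trans ih
  have : Nonempty (V × Bool) := ⟨(u₀, true)⟩
  refine ⟨?_⟩
  rintro ⟨u, b⟩ ⟨v, b'⟩
  obtain ⟨x, hx⟩ := hnb u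
  obtain ⟨p⟩ := hc.preconnected u v
  exact ((hadj u x hx b b').trans (hadj x u hx.symm b' b')).trans (hwalk u v p b')

/-- A vertex with a neighbor has neighbors in all ways, so an edge never leads to a dead end. -/
lemma exists_adj_ne (hX : X.IsSaturated g) (hmn : 3 ≤ 2 * m + n) (hg : g ≠ 0) {u v : V}
    (huv : X.underlying.Adj u v) : ∃ w, w ≠ u ∧ X.underlying.Adj v w := by
  obtain ⟨s, hs⟩ := X.underlying_adj.1 huv.symm
  have hcard : 1 < Fintype.card (Letter m n) := by
    simp [Fintype.card_sum, Fintype.card_prod]; omega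
  have := Fintype.one_lt_card_iff_nontrivial.1 hcard
  obtain ⟨t, ht⟩ := exists_ne s
  obtain ⟨k, rfl⟩ := Nat.exists_eq_succ_of_ne_zero hg
  obtain ⟨w, hw, -⟩ := hX v u huv.symm (List.replicate (k + 1) t) (by simp)
  refine ⟨w, ?_, X.underlying_adj.2 ⟨t, hw⟩⟩
  rintro rfl
  exact ht (X.step_unique hw hs)

/-- No adjacency is counted twice among the arcs and edges of all colors. -/
lemma card_arcs_add_card_edges_le [Finite V] (X : ColoredMixedGraph m n V) :
    ∑ i, Nat.card {p : V × V // X.Arc i p.1 p.2} + ∑ j, Nat.card (X.edgeGraph j).edgeSet ≤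
      Nat.card X.underlying.edgeSet := by
  have harc : ∀ i (p : {p : V × V // X.Arc i p.1 p.2}), X.underlying.Adj p.1.1 p.1.2 :=
    fun i p => Or.inl ⟨i, p.2⟩
  have hedge : ∀ j, X.edgeGraph j ≤ X.underlying := fun j u v h => Or.inr (Or.inr ⟨j, h⟩)
  let f : (Σ i, {p : V × V // X.Arc i p.1 p.2}) ⊕ (Σ j, (X.edgeGraph j).edgeSet) →
      X.underlying.edgeSet := Sum.elim (fun x => ⟨s(x.2.1.1, x.2.1.2), harc x.1 x.2⟩)
        (fun x => ⟨x.2.1, SimpleGraph.edgeSet_mono (hedge x.1) x.2.2⟩)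
  have hf : Function.Injective f := by
    have key : ∀ i u v j e, X.Arc i u v → e ∈ (X.edgeGraph j).edgeSet → s(u, v) ≠ e := by
      rintro i u v j e h1 h2 rfl
      exact X.arc_not_edge i j u v h1 h2
    rintro (⟨i, ⟨⟨u, v⟩, h⟩⟩ | ⟨j, ⟨e, h⟩⟩) (⟨i', ⟨⟨u', v'⟩, h'⟩⟩ | ⟨j', ⟨e', h'⟩⟩) heq
    · rcases Sym2.eq_iff.1 (congrArg Subtype.val heq) with ⟨rfl, rfl⟩ | ⟨rfl, rfl⟩
      · obtain rfl := X.arc_unique i i' _ _ h h'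
        rfl
      · exact absurd h' (X.arc_asymm i i' _ _ h)
    · exact absurd (congrArg Subtype.val heq) (key i u v j' e' h h')
    · exact absurd (congrArg Subtype.val heq).symm (key i' u' v' j e h' h)
    · obtain rfl : e = e' := congrArg Subtype.val heq
      induction e with
      | h u v =>
        obtain rfl := X.edge_unique j j' u v h h'
        rfl
  have := Nat.card_le_card_of_injective f hf
  rwa [Nat.card_sum, Nat.card_sigma, Nat.card_sigma] at this

/-- The connected bipartite double of the arcs has `2 * |V|` vertices, and hence at least
`2 * |V| - 1` edges. -/
lemma two_mul_card_le [Finite V] {i : Fin m} (h : (X.arcDouble i).Connected) :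
    2 * Nat.card V ≤ Nat.card {p : V × V // X.Arc i p.1 p.2} + 1 := by
  have h1 := h.card_vert_le_card_edgeSet_add_one
  rw [Nat.card_prod, Nat.card_eq_fintype_card (α := Bool), Fintype.card_bool] at h1
  let f : {p : V × V // X.Arc i p.1 p.2} → (X.arcDouble i).edgeSet := fun p =>
    ⟨s((p.1.1, true), (p.1.2, false)), by simp, p.2⟩
  have hf : Function.Surjective f := by
    rintro ⟨e, he⟩
    induction e with
    | h a b =>
      obtain ⟨u, k⟩ := a
      obtain ⟨v, l⟩ := b
      obtain ⟨hne, hs⟩ := he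
      cases k <;> cases l
      · exact absurd rfl hne
      · exact ⟨⟨(v, u), hs⟩, Subtype.ext Sym2.eq_swap⟩
      · exact ⟨⟨(u, v), hs⟩, rfl⟩
      · exact absurd rfl hne
  have h2 := Nat.card_le_card_of_surjective f hf
  omega

/-- A connected saturated graph is dense: each of the `n` colors of edges contributes a connected
spanning subgraph, and each of the `m` colors of arcs a connected bipartite double. -/
theorem three_mul_card_le [Finite V] (hX : X.IsSaturated g) (hmn : 3 ≤ 2 * m + n)
    (hc : X.underlying.Connected) (hnb : ∀ u, ∃ v, X.underlying.Adj u v) :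
    3 * Nat.card V ≤ Nat.card X.underlying.edgeSet + 3 := by
  have hV : 0 < Nat.card V := by
    have := hc.nonempty
    exact Nat.card_pos
  have h1 : m * (2 * Nat.card V - 1) ≤ ∑ i, Nat.card {p : V × V // X.Arc i p.1 p.2} := by
    have := Finset.card_nsmul_le_sum Finset.univ
      (fun i => Nat.card {p : V × V // X.Arc i p.1 p.2}) (2 * Nat.card V - 1)
      fun i _ => by have := two_mul_card_le (arcDouble_connected hX hc hnb i); omega
    simpa using this
  have h2 : n * (Nat.card V - 1) ≤ ∑ j, Nat.card (X.edgeGraph j).edgeSet := by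
    have := Finset.card_nsmul_le_sum Finset.univ
      (fun j => Nat.card (X.edgeGraph j).edgeSet) (Nat.card V - 1)
      fun j _ => by
        have := (edgeGraph_connected hX hc j).card_vert_le_card_edgeSet_add_one
        omega
    simpa using this
  have h3 := X.card_arcs_add_card_edges_le
  obtain ⟨k, hk⟩ : ∃ k, Nat.card V = k + 1 := ⟨Nat.card V - 1, by omega⟩
  rw [hk] at h1 h2 ⊢
  have e1 : 2 * (k + 1) - 1 = 2 * k + 1 := by omega
  rw [e1] at h1
  rw [Nat.add_sub_cancel] at h2
  nlinarith [Nat.mul_le_mul_right k hmn]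

end Counting

/-! ### Restriction to a component -/

lemma comap_underlying_adj {V W : Type*} (X : ColoredMixedGraph m n W) (f : V → W) {u v : V} :
    (X.comap f).underlying.Adj u v ↔ X.underlying.Adj (f u) (f v) := by
  simp only [underlying_adj, comap_step]

/-- The restriction of a drawing along an injective graph homomorphism. -/
def _root_.PlaneDrawing.comap {V W : Type*} {G : SimpleGraph V} {H : SimpleGraph W}
    (P : PlaneDrawing H) (f : G →g H) (hf : Function.Injective f) : PlaneDrawing G where
  point := P.point ∘ f
  curve e := P.curve (e.map f)
  point_injective := P.point_injective.comp hf
  isPolygonalArc u v h := P.isPolygonalArc _ _ (f.map_adj h)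
  mem_of_point_mem e he w hw := by
    induction e with
    | h a b =>
      rcases Sym2.mem_iff.1 (P.mem_of_point_mem _ (f.map_adj he) _ hw) with h | h
      · exact Sym2.mem_iff.2 (Or.inl (hf h))
      · exact Sym2.mem_iff.2 (Or.inr (hf h))
  eq_point_of_mem e he e' he' hne p hp hp' := by
    have hmap : ∀ {e}, e ∈ G.edgeSet → e.map f ∈ H.edgeSet := by
      intro e he
      induction e with
      | h a b => exact f.map_adj he
    obtain ⟨w, h1, h2, rfl⟩ := P.eq_point_of_mem _ (hmap he) _ (hmap he')
      (fun h => hne (Sym2.map.injective hf h)) p hp hp'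
    obtain ⟨a, ha, rfl⟩ := Sym2.mem_map.1 h1
    obtain ⟨b, hb, hab⟩ := Sym2.mem_map.1 h2
    rw [hf hab] at hb
    exact ⟨a, ha, hb, rfl⟩

/-- A walk that starts in a component stays there. -/
lemma spells_comap_component {W : Type*} {X : ColoredMixedGraph m n W} {r : W}
    {w : List (Letter m n)} {u v : {x // X.underlying.Reachable r x}}
    (h : X.Spells w u.1 v.1) : (X.comap Subtype.val).Spells w u v := by
  induction w generalizing u with
  | nil => exact Subtype.ext h
  | cons t w ih =>
    obtain ⟨x, h1, h2⟩ := h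
    have hx : X.underlying.Adj u.1 x := X.underlying_adj.2 ⟨t, h1⟩
    exact ⟨⟨x, u.2.trans hx.reachable⟩, X.comap_step.2 h1, ih h2⟩

lemma connected_comap_component {W : Type*} (X : ColoredMixedGraph m n W) (r : W) :
    (X.comap (Subtype.val : {x // X.underlying.Reachable r x} → W)).underlying.Connected := by
  have key : ∀ u v (_ : X.underlying.Walk u v) (hu : X.underlying.Reachable r u)
      (hv : X.underlying.Reachable r v),
      (X.comap (Subtype.val : {x // X.underlying.Reachable r x} → W)).underlying.Reachable
        ⟨u, hu⟩ ⟨v, hv⟩ := by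
    intro u v p hu hv
    induction p with
    | nil => exact .rfl
    | cons h p ih =>
      refine SimpleGraph.Reachable.trans (SimpleGraph.Adj.reachable ?_)
        (ih (hu.trans h.reachable) hv)
      exact (X.comap_underlying_adj _).2 h
  have : Nonempty {x // X.underlying.Reachable r x} := ⟨⟨r, .rfl⟩⟩
  refine ⟨?_⟩
  rintro ⟨u, hu⟩ ⟨v, hv⟩
  obtain ⟨p⟩ := hu.symm.trans hv
  exact key u v p hu hv

/-- A planar graph in which every long word is spelled between any two adjacent vertices has no
edges. -/
theorem not_adj_of_isSaturated {W : Type*} [Finite W] {g : ℕ} {X : ColoredMixedGraph m n W}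
    (hX : X.IsSaturated g) (hg : g ≠ 0) (hmn : 3 ≤ 2 * m + n) (P : PlaneDrawing X.underlying)
    (r s : W) : ¬ X.underlying.Adj r s := by
  classical
  intro hrs
  let K := {x // X.underlying.Reachable r x}
  let Y : ColoredMixedGraph m n K := X.comap Subtype.val
  have hYX : ∀ u v : K, Y.underlying.Adj u v ↔ X.underlying.Adj u.1 v.1 := fun u v =>
    X.comap_underlying_adj _
  have hY : Y.IsSaturated g := fun u v huv w hw =>
    spells_comap_component (hX _ _ ((hYX u v).1 huv) w hw)
  have hc : Y.underlying.Connected := X.connected_comap_component r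
  have hrs' : Y.underlying.Adj ⟨r, .rfl⟩ ⟨s, hrs.reachable⟩ := (hYX _ _).2 hrs
  have hnb : ∀ u, ∃ v, Y.underlying.Adj u v := by
    intro u
    obtain ⟨p⟩ := hc.preconnected u ⟨r, .rfl⟩
    rcases p with _ | ⟨h, -⟩
    · exact ⟨_, hrs'⟩
    · exact ⟨_, h⟩
  have := Fintype.ofFinite K
  have : Nonempty Y.underlying.Dart := ⟨⟨(_, _), hrs'⟩⟩
  have P' : PlaneDrawing Y.underlying :=
    P.comap ⟨Subtype.val, fun h => (hYX _ _).1 h⟩ Subtype.val_injective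
  have h1 := P'.card_edgeSet_add_six_le fun d => exists_adj_ne hY hmn hg d.adj
  have h2 := three_mul_card_le hY hmn hc hnb
  rw [Nat.card_eq_fintype_card, Nat.card_eq_fintype_card] at h2
  omega

end ColoredMixedGraph

theorem theorem2 (m n g : ℕ) (hg : 3 ≤ g) (hmn : 3 ≤ 2 * m + n) :
    ¬ ∃ (W : Type) (_ : Finite W) (T : ColoredMixedGraph m n W),
      T.IsPlanar ∧ T.IsUniversal g := by
  rintro ⟨W, hW, T, ⟨P⟩, hT⟩
  obtain ⟨X, hX, hXT, hsat⟩ := T.exists_isSaturated_target hg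
    fun U _ G H hs => hT U G hs.isPlanarOfGirthAtLeast
  have hcard : 0 < Fintype.card (ColoredMixedGraph.Letter m n) := by
    simp [Fintype.card_sum, Fintype.card_prod]; omega
  obtain ⟨t⟩ := Fintype.card_pos_iff.1 hcard
  obtain ⟨G, H, hs, hstep⟩ := ColoredMixedGraph.exists_isSketch_step g t
  obtain ⟨φ, hφ⟩ := hX Bool G H hs
  exact ColoredMixedGraph.not_adj_of_isSaturated hsat (by omega) hmn
    (P.comap (SimpleGraph.Hom.ofLE hXT) Function.injective_id) _ _
    (hφ.adj (G.underlying_adj.2 ⟨t, hstep⟩))
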